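/- Let $\ell\in\{\tfrac12,\tfrac32,\tfrac52,\dots\}$ be a positive odd half-integer, and let $K$ be a field of characteristic zero (for instance $\mathbb R$ or $\mathbb C$). Let $\mathfrak g$ be the Lie algebra over $K$ with basis $C,D,H,M,P_0,P_1,\dots,P_{2\ell}$ (the centrally extended spin-$\ell$ conformal Galilei algebra in one spatial dimension) whose non-zero brackets are, up to antisymmetry, $$[D,H]=2H,\quad [D,C]=-2C,\quad [C,H]=D,$$ $$[H,P_n]=-nP_{n-1},\quad [D,P_n]=2(\ell-n)P_n,\quad [C,P_n]=(2\ell-n)P_{n+1},$$ $$[P_m,P_n]=\delta_{m+n,2\ell}\,I_m\,M,\qquad I_m=(-1)^{m+\ell+\frac12}\,m!\,(2\ell-m)!.$$ Let $\mathfrak g^+$ be the span of $H,P_0,\dots,P_{\ell-\frac12}$. For $\delta,\mu\in K$ let $V^{\delta,\mu}$ be the Verma module with highest weight vector $|\delta,\mu\rangle$, that is, the quotient of the universal enveloping algebra $U(\mathfrak g)$ by the left ideal generated by $\mathfrak g^+$, $D-\delta$ and $M-\mu$, with $|\delta,\mu\rangle$ the class of $1$. For $m\ge 0$ consider all $h,k_0,\dots,k_{\ell-\frac12}\in\{0,1,2,\dots\}$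 with $2h+\sum_{j=0}^{\ell-1/2}(2j+1)k_j=m$. Write $\vec k=(k_1,\dots,k_{\ell-\frac12})$ (so that $k_0$ is determined by $m,h,\vec k$) and $$|h,\vec k;m\rangle=C^h\prod_{j=0}^{\ell-\frac12}P_{\ell+\frac12+j}^{k_j}\,|\delta,\mu\rangle .$$ Let $V^{\delta,\mu}_m$ be the span of these vectors. A singular vector at level $m$, where $m\ge 1$, is a non-zero $u\in V^{\delta,\mu}_m$ with $Xu=0$ for all $X\in\mathfrak g^+$. Assume $\mu\ne 0$. Then: 1. If $u_m=\sum_{h,\vec k}a_{h,\vec k}\,|h,\vec k;m\rangle$ is a singular vector at level $m$, then $m$ is even. 2. For given $m$, the coefficients are unique up to an overall factor: if $\sum a_{h,\vec k}|h,\vec k;m\rangle$ and $\sum b_{h,\vec k}|h,\vec k;m\rangle$ are singular vectors at level $m$, then there is a non-zero $c\in K$ with $b_{h,\vec k}=c\,a_{h,\vec k}$ for all $h,\vec k$. 3. If there is a singular vector at level $m$, then $m=2q$ for an integer $q\ge 1$ with $$2\delta-2(q-1)+\left(\ell+\tfrac12\right)^2=0 .$$ 4. Conversely, if $q\ge 1$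 is an integer satisfying this equation, then $$|u_{2q}\rangle=\left(\alpha_\ell\,\mu\,C-P_{\ell+\frac12}^2\right)^q|\delta,\mu\rangle,\qquad \alpha_\ell=2\left((\ell-\tfrac12)!\right)^2,$$ is a singular vector at level $2q$, and every singular vector of $V^{\delta,\mu}$, at whatever level, is at level $2q$ and is a non-zero multiple of $|u_{2q}\rangle$. -/

import Mathlib

/-- The generators of the centrally extended spin-`ℓ` conformal Galilei algebra in one spatial
dimension, where `ℓ = p + 1/2`: these are `C`, `D`, `H`, the central element `M`, and `P_n` for
`0 ≤ n ≤ 2ℓ = 2p + 1`. -/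
inductive CGAGen (p : ℕ) : Type
  | C : CGAGen p
  | D : CGAGen p
  | H : CGAGen p
  | M : CGAGen p
  | P (n : Fin (2 * p + 2)) : CGAGen p

/-- The underlying vector space of the algebra, with basis `C, D, H, M, P_0, …, P_{2p+1}`. -/
def CGA (K : Type*) [Field K] (p : ℕ) : Type _ := CGAGen p →₀ K

namespace CGA

noncomputable instance (K : Type*) [Field K] (p : ℕ) : AddCommGroup (CGA K p) :=
  inferInstanceAs (AddCommGroup (CGAGen p →₀ K))

noncomputable instance (K : Type*) [Field K] (p : ℕ) : Module K (CGA K p) :=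
  inferInstanceAs (Module K (CGAGen p →₀ K))

/-- The basis vector attached to a generator. -/
noncomputable def gen (K : Type*) [Field K] {p : ℕ} (a : CGAGen p) : CGA K p :=
  (Finsupp.single a (1 : K) : CGAGen p →₀ K)

/-- `C` as an element of the algebra. -/
noncomputable def C (K : Type*) [Field K] (p : ℕ) : CGA K p := gen K CGAGen.C

/-- `D` as an element of the algebra. -/
noncomputable def D (K : Type*) [Field K] (p : ℕ) : CGA K p := gen K CGAGen.D

/-- `H` as an element of the algebra. -/
noncomputable def H (K : Type*) [Field K] (p : ℕ) : CGA K p := gen K CGAGen.H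

/-- `M` as an element of the algebra. -/
noncomputable def M (K : Type*) [Field K] (p : ℕ) : CGA K p := gen K CGAGen.M

/-- `P_n` as an element of the algebra for `0 ≤ n ≤ 2p + 1` (and `0` for other `n`). -/
noncomputable def P (K : Type*) [Field K] (p : ℕ) (n : ℕ) : CGA K p :=
  if hn : n < 2 * p + 2 then gen K (CGAGen.P ⟨n, hn⟩) else 0

/-- The structure constant `I_m = (-1)^(m+ℓ+1/2) m! (2ℓ-m)!`, for `0 ≤ m ≤ 2ℓ = 2p + 1`. -/
def structI (K : Type*) [Field K] (p : ℕ) (m : ℕ) : K :=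
  (-1) ^ (m + p + 1) * (m.factorial : K) * ((2 * p + 1 - m).factorial : K)

/-- The bracket on generators (recall `2ℓ = 2p + 1`). -/
noncomputable def genBracket (K : Type*) [Field K] (p : ℕ) : CGAGen p → CGAGen p → CGA K p
  | .D, .H => (2 : K) • H K p
  | .H, .D => -((2 : K) • H K p)
  | .D, .C => -((2 : K) • C K p)
  | .C, .D => (2 : K) • C K p
  | .C, .H => D K p
  | .H, .C => -D K p
  | .H, .P n => -((n.val : K) • P K p (n.val - 1))
  | .P n, .H => (n.val : K) • P K p (n.val - 1)
  | .D, .P n => ((2 * p + 1 : K) - 2 * (n.val : K)) • P K p n.val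
  | .P n, .D => -(((2 * p + 1 : K) - 2 * (n.val : K)) • P K p n.val)
  | .C, .P n => ((2 * p + 1 : K) - (n.val : K)) • P K p (n.val + 1)
  | .P n, .C => -(((2 * p + 1 : K) - (n.val : K)) • P K p (n.val + 1))
  | .P m, .P n => if m.val + n.val = 2 * p + 1 then structI K p m.val • M K p else 0
  | _, _ => 0

/-- The bilinear extension of the bracket of generators. -/
noncomputable def bracket (K : Type*) [Field K] (p : ℕ) :
    CGA K p →ₗ[K] CGA K p →ₗ[K] CGA K p :=
  (Finsupp.linearCombination K fun a : CGAGen p =>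
    (Finsupp.linearCombination K (genBracket K p a) : (CGAGen p →₀ K) →ₗ[K] CGA K p) :
    (CGAGen p →₀ K) →ₗ[K] (CGAGen p →₀ K) →ₗ[K] CGA K p)

theorem bracket_gen (K : Type*) [Field K] (p : ℕ) (a b : CGAGen p) :
    bracket K p (gen K a) (gen K b) = genBracket K p a b := by
  show (Finsupp.linearCombination K _ (Finsupp.single a (1 : K)) :
    (CGAGen p →₀ K) →ₗ[K] CGA K p) (Finsupp.single b (1 : K)) = _
  simp

theorem P_val (K : Type*) [Field K] (p : ℕ) (n : Fin (2 * p + 2)) :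
    gen K (CGAGen.P n) = P K p n.val := by
  simp [P]

theorem P_of_ge (K : Type*) [Field K] (p n : ℕ) (hn : 2 * p + 2 ≤ n) : P K p n = 0 := by
  simp [P, hn]

theorem induction_gen {K : Type*} [Field K] {p : ℕ} {q : CGA K p → Prop} (x : CGA K p)
    (h0 : q 0) (hadd : ∀ x y, q x → q y → q (x + y)) (hs : ∀ (c : K) a, q (c • gen K a)) :
    q x := by
  refine Finsupp.induction_linear (motive := q) x h0 hadd fun a c => ?_
  have h : (Finsupp.single a c : CGAGen p →₀ K) = c • Finsupp.single a (1 : K) := by simp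
  rw [h]
  exact hs c a

theorem genBracket_skew (K : Type*) [Field K] (p : ℕ) (a b : CGAGen p) :
    genBracket K p a b = -genBracket K p b a := by
  rcases a with _ | _ | _ | _ | m <;> rcases b with _ | _ | _ | _ | n <;>
    simp only [genBracket, neg_neg, neg_zero]
  by_cases h : m.val + n.val = 2 * p + 1
  · have h' : n.val + m.val = 2 * p + 1 := by omega
    rw [if_pos h, if_pos h', ← neg_smul]
    congr 1
    have e1 : 2 * p + 1 - m.val = n.val := by omega
    have e2 : 2 * p + 1 - n.val = m.val := by omega
    have e3 : (-1 : K) ^ (m.val + p + 1) = -(-1) ^ (n.val + p + 1) := by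
      rcases Nat.even_or_odd (n.val + p + 1) with he | he
      · have ho : Odd (m.val + p + 1) := by grind
        rw [he.neg_one_pow, ho.neg_one_pow]
      · have ho : Even (m.val + p + 1) := by grind
        rw [he.neg_one_pow, ho.neg_one_pow]; simp
    simp only [structI, e1, e2, e3]
    ring
  · have h' : ¬ n.val + m.val = 2 * p + 1 := by omega
    simp [h, h']

theorem bracket_P (K : Type*) [Field K] (p : ℕ) (a : CGAGen p) (n : ℕ) (hn : n < 2 * p + 2) :
    bracket K p (gen K a) (P K p n) = genBracket K p a (.P ⟨n, hn⟩) := by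
  rw [← bracket_gen, P_val]

theorem bracket_C_P (K : Type*) [Field K] (p : ℕ) (n : ℕ) (hn : n < 2 * p + 2) :
    bracket K p (C K p) (P K p n) = ((2 * p + 1 : K) - (n : K)) • P K p (n + 1) :=
  bracket_P K p .C n hn

theorem bracket_D_P (K : Type*) [Field K] (p : ℕ) (n : ℕ) :
    bracket K p (D K p) (P K p n) = ((2 * p + 1 : K) - 2 * (n : K)) • P K p n := by
  by_cases hn : n < 2 * p + 2
  · exact bracket_P K p .D n hn
  · simp [P_of_ge K p n (by omega)]

theorem bracket_H_P (K : Type*) [Field K] (p : ℕ) (n : ℕ) (hn : n < 2 * p + 2) :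
    bracket K p (H K p) (P K p n) = -((n : K) • P K p (n - 1)) :=
  bracket_P K p .H n hn

theorem bracket_M_P (K : Type*) [Field K] (p : ℕ) (n : ℕ) :
    bracket K p (M K p) (P K p n) = 0 := by
  by_cases hn : n < 2 * p + 2
  · exact bracket_P K p .M n hn
  · simp [P_of_ge K p n (by omega)]

theorem bracket_P_P (K : Type*) [Field K] (p : ℕ) (m n : ℕ) :
    bracket K p (P K p m) (P K p n) =
      if m + n = 2 * p + 1 then structI K p m • M K p else 0 := by
  by_cases hm : m < 2 * p + 2
  · by_cases hn : n < 2 * p + 2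
    · rw [← P_val K p ⟨m, hm⟩]
      exact bracket_P K p (.P ⟨m, hm⟩) n hn
    · rw [P_of_ge K p n (by omega), if_neg (by omega)]; simp
  · rw [P_of_ge K p m (by omega), if_neg (by omega)]; simp

theorem bracket_skew (K : Type*) [Field K] (p : ℕ) (x y : CGA K p) :
    bracket K p x y = -bracket K p y x := by
  induction x using induction_gen with
  | h0 => simp
  | hadd x x' h h' => simp [h, h', add_comm]
  | hs s a =>
    induction y using induction_gen with
    | h0 => simp
    | hadd y y' h h' => simp only [map_add, h, h', LinearMap.add_apply]; abel
    | hs t b =>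
      simp only [map_smul, LinearMap.smul_apply, bracket_gen]
      rw [genBracket_skew, smul_comm]; simp

theorem jacobi_rotate (K : Type*) [Field K] (p : ℕ) (x y z : CGA K p)
    (h : bracket K p x (bracket K p y z) =
      bracket K p (bracket K p x y) z + bracket K p y (bracket K p x z)) :
    bracket K p y (bracket K p z x) =
      bracket K p (bracket K p y z) x + bracket K p z (bracket K p y x) := by
  rw [bracket_skew K p (bracket K p y z) x, h, bracket_skew K p z x, bracket_skew K p y x,
    bracket_skew K p (bracket K p x y) z]
  simp only [map_neg]
  abel

theorem jacobi_swap (K : Type*) [Field K] (p : ℕ) (x y z : CGA K p)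
    (h : bracket K p x (bracket K p y z) =
      bracket K p (bracket K p x y) z + bracket K p y (bracket K p x z)) :
    bracket K p y (bracket K p x z) =
      bracket K p (bracket K p y x) z + bracket K p x (bracket K p y z) := by
  rw [h, bracket_skew K p y x]
  simp

/-- The Jacobi identity for a triple of elements. -/
def Jac (K : Type*) [Field K] (p : ℕ) (x y z : CGA K p) : Prop :=
  bracket K p x (bracket K p y z) =
    bracket K p (bracket K p x y) z + bracket K p y (bracket K p x z)

theorem jac_C_D_P (K : Type*) [Field K] (p n : ℕ) (hn : n < 2 * p + 2) :
    Jac K p (C K p) (D K p) (P K p n) := by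
  have h : bracket K p (C K p) (D K p) = (2 : K) • C K p := bracket_gen K p .C .D
  simp only [Jac, h, bracket_C_P K p n hn, bracket_D_P, map_smul, LinearMap.smul_apply]
  push_cast
  module

theorem jac_H_D_P (K : Type*) [Field K] (p n : ℕ) (hn : n < 2 * p + 2) :
    Jac K p (H K p) (D K p) (P K p n) := by
  have h : bracket K p (H K p) (D K p) = -((2 : K) • H K p) := bracket_gen K p .H .D
  simp only [Jac, h, bracket_H_P K p n hn, bracket_D_P, map_smul, LinearMap.smul_apply, map_neg,
    LinearMap.neg_apply]
  rcases n with _ | n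
  · simp
  · simp only [Nat.add_sub_cancel]
    push_cast
    module

theorem jac_C_H_P (K : Type*) [Field K] (p n : ℕ) (hn : n < 2 * p + 2) :
    Jac K p (C K p) (H K p) (P K p n) := by
  have h : bracket K p (C K p) (H K p) = D K p := bracket_gen K p .C .H
  simp only [Jac, h, bracket_H_P K p n hn, bracket_D_P, bracket_C_P K p n hn, map_smul,
    map_neg]
  have e1 : (n : K) • bracket K p (C K p) (P K p (n - 1)) =
      ((n : K) * ((2 * p + 1 : K) - (n : K) + 1)) • P K p n := by
    rcases n with _ | n
    · simp
    · rw [Nat.add_sub_cancel, bracket_C_P K p n (by omega)]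
      push_cast
      module
  have e2 : ((2 * p + 1 : K) - (n : K)) • bracket K p (H K p) (P K p (n + 1)) =
      -((((2 * p + 1 : K) - (n : K)) * ((n : K) + 1)) • P K p n) := by
    by_cases h' : n + 1 < 2 * p + 2
    · rw [bracket_H_P K p (n + 1) h', Nat.add_sub_cancel]
      push_cast
      module
    · have h1 : n = 2 * p + 1 := by omega
      subst h1
      push_cast
      simp
  rw [e1, e2]
  module

theorem bracket_M_left (K : Type*) [Field K] (p : ℕ) (x : CGA K p) :
    bracket K p (M K p) x = 0 := by
  induction x using induction_gen with
  | h0 => simp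
  | hadd x y hx hy => simp [hx, hy]
  | hs s a =>
    have h : bracket K p (M K p) (gen K a) = 0 := by
      refine (bracket_gen K p .M a).trans ?_
      cases a <;> rfl
    simp [h]

theorem bracket_M_right (K : Type*) [Field K] (p : ℕ) (x : CGA K p) :
    bracket K p x (M K p) = 0 := by
  rw [bracket_skew, bracket_M_left, neg_zero]

theorem jac_D_P_P (K : Type*) [Field K] (p m n : ℕ) :
    Jac K p (D K p) (P K p m) (P K p n) := by
  simp only [Jac, bracket_D_P, bracket_P_P, map_smul, LinearMap.smul_apply]
  split_ifs with h
  · have h' : (m : K) + n = 2 * p + 1 := by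
      have h1 := congrArg (Nat.cast : ℕ → K) h
      push_cast at h1
      exact h1
    have e : ((2 * p + 1 : K) - 2 * (n : K)) = -((2 * p + 1 : K) - 2 * (m : K)) := by
      linear_combination (-2) * h'
    simp only [map_smul, bracket_M_right, e]
    module
  · simp

theorem jac_C_P_P (K : Type*) [Field K] (p m n : ℕ) (hm : m < 2 * p + 2)
    (hn : n < 2 * p + 2) : Jac K p (C K p) (P K p m) (P K p n) := by
  simp only [Jac, bracket_C_P K p m hm, bracket_C_P K p n hn, bracket_P_P, map_smul,
    LinearMap.smul_apply]
  have e0 : bracket K p (C K p) (if m + n = 2 * p + 1 then structI K p m • M K p else 0) = 0 := by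
    split_ifs <;> simp [bracket_M_right]
  rw [e0]
  by_cases h : m + n = 2 * p
  · rw [if_pos (by omega), if_pos (by omega), smul_smul, smul_smul, ← add_smul]
    have h' : (m : K) + n = 2 * p := by
      have h1 := congrArg (Nat.cast : ℕ → K) h
      push_cast at h1
      exact h1
    have e1 : 2 * p + 1 - (m + 1) = n := by omega
    have e2 : 2 * p + 1 - m = n + 1 := by omega
    simp only [structI, e1, e2, Nat.factorial_succ]
    have e3 : (2 * p + 1 : K) - m = n + 1 := by linear_combination -h'
    have e4 : (2 * p + 1 : K) - n = m + 1 := by linear_combination -h'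
    rw [e3, e4]
    symm
    push_cast
    convert zero_smul K (M K p) using 2
    ring
  · rw [if_neg (by omega), if_neg (by omega)]; simp

theorem jac_H_P_P (K : Type*) [Field K] (p m n : ℕ) (hm : m < 2 * p + 2)
    (hn : n < 2 * p + 2) : Jac K p (H K p) (P K p m) (P K p n) := by
  simp only [Jac, bracket_H_P K p m hm, bracket_H_P K p n hn, bracket_P_P, map_smul,
    LinearMap.smul_apply, map_neg, LinearMap.neg_apply]
  have e0 : bracket K p (H K p) (if m + n = 2 * p + 1 then structI K p m • M K p else 0) = 0 := by
    split_ifs <;> simp [bracket_M_right]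
  rw [e0]
  rcases m with _ | m
  · rcases n with _ | n
    · simp
    · rw [if_neg (c := 0 + (n + 1 - 1) = 2 * p + 1) (by omega)]; simp
  · rcases n with _ | n
    · rw [if_neg (c := m + 1 - 1 + 0 = 2 * p + 1) (by omega)]; simp
    · simp only [Nat.add_sub_cancel]
      by_cases h : m + n = 2 * p
      · rw [if_pos (by omega), if_pos (by omega), smul_smul, smul_smul, ← neg_smul, ← neg_smul,
          ← add_smul]
        have e1 : 2 * p + 1 - (m + 1) = n := by omega
        have e2 : 2 * p + 1 - m = n + 1 := by omega
        simp only [structI, e1, e2, Nat.factorial_succ]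
        symm
        push_cast
        convert zero_smul K (M K p) using 2
        ring
      · rw [if_neg (by omega), if_neg (by omega)]; simp

theorem jac_P_P_P (K : Type*) [Field K] (p l m n : ℕ) :
    Jac K p (P K p l) (P K p m) (P K p n) := by
  simp only [Jac, bracket_P_P]
  split_ifs <;> simp [bracket_M_right, bracket_M_left]

theorem Jac.rotate {K : Type*} [Field K] {p : ℕ} {x y z : CGA K p} (h : Jac K p x y z) :
    Jac K p y z x := jacobi_rotate K p x y z h

theorem Jac.swap {K : Type*} [Field K] {p : ℕ} {x y z : CGA K p} (h : Jac K p x y z) :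
    Jac K p y x z := jacobi_swap K p x y z h

theorem jac_same (K : Type*) [Field K] (p : ℕ) (x y : CGA K p) (hx : bracket K p x x = 0) :
    Jac K p x x y := by
  simp [Jac, hx]

theorem jac_M (K : Type*) [Field K] (p : ℕ) (x y : CGA K p) : Jac K p (M K p) x y := by
  simp [Jac, bracket_M_left]

theorem jac_C_D_H (K : Type*) [Field K] (p : ℕ) : Jac K p (C K p) (D K p) (H K p) := by
  have h1 : bracket K p (C K p) (D K p) = (2 : K) • C K p := bracket_gen K p .C .D
  have h2 : bracket K p (D K p) (H K p) = (2 : K) • H K p := bracket_gen K p .D .H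
  have h3 : bracket K p (C K p) (H K p) = D K p := bracket_gen K p .C .H
  have h4 : bracket K p (D K p) (D K p) = 0 := bracket_gen K p .D .D
  simp [Jac, h1, h2, h3, h4]

set_option maxHeartbeats 1000000 in
theorem jacobi_gen (K : Type*) [Field K] (p : ℕ) (a b c : CGAGen p) :
    Jac K p (gen K a) (gen K b) (gen K c) := by
  have hC : bracket K p (C K p) (C K p) = 0 := bracket_gen K p .C .C
  have hD : bracket K p (D K p) (D K p) = 0 := bracket_gen K p .D .D
  have hH : bracket K p (H K p) (H K p) = 0 := bracket_gen K p .H .H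
  have gC : (gen K CGAGen.C : CGA K p) = C K p := rfl
  have gD : (gen K CGAGen.D : CGA K p) = D K p := rfl
  have gH : (gen K CGAGen.H : CGA K p) = H K p := rfl
  have gM : (gen K CGAGen.M : CGA K p) = M K p := rfl
  -- every triple is a permutation of one of the triples treated above
  have perm : ∀ x y z : CGA K p, (Jac K p x y z ∨ Jac K p x z y ∨ Jac K p y x z ∨
      Jac K p y z x ∨ Jac K p z x y ∨ Jac K p z y x) → Jac K p x y z := by
    rintro x y z (h | h | h | h | h | h)
    · exact h
    · exact h.swap.rotate
    · exact h.swap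
    · exact h.rotate.rotate
    · exact h.rotate
    · exact h.swap.rotate.rotate
  rcases a with _ | _ | _ | _ | l <;> rcases b with _ | _ | _ | _ | m <;>
    rcases c with _ | _ | _ | _ | n <;> simp only [P_val, gC, gD, gH, gM] <;> apply perm <;>
    simp only [jac_M, jac_same, hC, hD, hH, jac_C_D_H, jac_C_D_P, jac_H_D_P, jac_C_H_P,
      jac_C_P_P, jac_D_P_P, jac_H_P_P, jac_P_P_P, Fin.is_lt, true_or, or_true]

theorem bracket_jacobi (K : Type*) [Field K] (p : ℕ) (x y z : CGA K p) :
    bracket K p x (bracket K p y z) =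
      bracket K p (bracket K p x y) z + bracket K p y (bracket K p x z) := by
  induction x using induction_gen with
  | h0 => simp
  | hadd x x' h h' => simp only [map_add, h, h', LinearMap.add_apply]; abel
  | hs s a =>
    induction y using induction_gen with
    | h0 => simp
    | hadd y y' h h' => simp only [map_add, h, h', LinearMap.add_apply]; abel
    | hs t b =>
      induction z using induction_gen with
      | h0 => simp
      | hadd z z' h h' => simp only [map_add, h, h']; abel
      | hs r c =>
        simp only [map_smul, LinearMap.smul_apply]
        rw [show _ = _ from jacobi_gen K p a b c]
        module

noncomputable instance (K : Type*) [Field K] [CharZero K] (p : ℕ) : LieRing (CGA K p) where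
  bracket x y := bracket K p x y
  add_lie x y z := by simp
  lie_add x y z := by simp
  lie_self x := by
    have h := bracket_skew K p x x
    have h2 : (2 : K) • bracket K p x x = 0 := by
      rw [two_smul]; nth_rewrite 1 [h]; simp
    exact (smul_eq_zero.mp h2).resolve_left two_ne_zero
  leibniz_lie x y z := bracket_jacobi K p x y z

noncomputable instance (K : Type*) [Field K] [CharZero K] (p : ℕ) : LieAlgebra K (CGA K p) where
  lie_smul c x y := map_smul (bracket K p x) c y

/-- The positive part `𝔤⁺` of the triangular decomposition: the span of
`H, P_0, P_1, …, P_{ℓ-1/2} = P_p`. -/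
noncomputable def plus (K : Type*) [Field K] (p : ℕ) : Submodule K (CGA K p) :=
  Submodule.span K ({H K p} ∪ {X | ∃ j : ℕ, j ≤ p ∧ X = P K p j})

/-- The universal enveloping algebra `U(𝔤)`. -/
abbrev U (K : Type*) [Field K] [CharZero K] (p : ℕ) : Type _ :=
  UniversalEnvelopingAlgebra K (CGA K p)

/-- The canonical image of an element of `𝔤` in `U(𝔤)`. -/
noncomputable abbrev toU {K : Type*} [Field K] [CharZero K] {p : ℕ} (X : CGA K p) : U K p :=
  UniversalEnvelopingAlgebra.ι K X

/-- The left ideal of `U(𝔤)` generated by `𝔤⁺`, `D - δ` and `M - μ`. -/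
noncomputable def vermaIdeal {K : Type*} [Field K] [CharZero K] (p : ℕ) (δ μ : K) :
    Submodule (U K p) (U K p) :=
  Submodule.span (U K p)
    ({x | ∃ X ∈ plus K p, x = toU X} ∪
      {toU (D K p) - algebraMap K (U K p) δ, toU (M K p) - algebraMap K (U K p) μ})

/-- The Verma module of highest weight `(δ, μ)`: the quotient of `U(𝔤)` by the left ideal
generated by `𝔤⁺`, `D - δ` and `M - μ`. -/
abbrev Verma {K : Type*} [Field K] [CharZero K] (p : ℕ) (δ μ : K) : Type _ :=
  U K p ⧸ vermaIdeal p δ μ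

/-- The highest weight vector `|δ, μ⟩`, i.e. the class of `1`. -/
noncomputable def hwv {K : Type*} [Field K] [CharZero K] (p : ℕ) (δ μ : K) : Verma p δ μ :=
  (vermaIdeal p δ μ).mkQ 1

/-- The exponents `(h, (k_0, …, k_p))`, where `p = ℓ - 1/2`, of the basis monomials of level `m`:
`2 h + ∑_{j=0}^{p} (2 j + 1) k_j = m`. (Thus `k_0` is determined by `m`, `h`, `k_1, …, k_p`.)
This is a finite set. -/
def LevelIndex (p m : ℕ) : Type :=
  {x : ℕ × (Fin (p + 1) → ℕ) // 2 * x.1 + ∑ j : Fin (p + 1), (2 * j.val + 1) * x.2 j = m}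

/-- The basis vector `C^h P_{ℓ+1/2}^{k_0} P_{ℓ+3/2}^{k_1} ⋯ P_{2ℓ}^{k_p} |δ, μ⟩`, where
`ℓ + 1/2 = p + 1`. -/
noncomputable def ket {K : Type*} [Field K] [CharZero K] (p : ℕ) (δ μ : K) (h : ℕ)
    (k : Fin (p + 1) → ℕ) : Verma p δ μ :=
  (toU (C K p) ^ h *
    (List.ofFn fun j : Fin (p + 1) => toU (P K p (p + 1 + j.val)) ^ k j).prod) • hwv p δ μ

/-- The vector `∑_{h,k} a_{h,k} |h, k; m⟩` with coefficients `a_{h,k}`. -/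
noncomputable def ketSum {K : Type*} [Field K] [CharZero K] (p : ℕ) (δ μ : K) {m : ℕ}
    (a : LevelIndex p m →₀ K) : Verma p δ μ :=
  a.sum fun i c => c • ket p δ μ i.val.1 i.val.2

/-- The level `m` subspace, spanned by the vectors `|h, k; m⟩`. -/
noncomputable def level {K : Type*} [Field K] [CharZero K] (p : ℕ) (δ μ : K) (m : ℕ) :
    Submodule K (Verma p δ μ) :=
  Submodule.span K (Set.range fun i : LevelIndex p m => ket p δ μ i.val.1 i.val.2)

/-- A singular vector at level `m`: a nonzero vector of level `m` that is annihilated by `𝔤⁺`,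
where level `0` (the multiples of the highest weight vector) is excluded. -/
def IsSingular {K : Type*} [Field K] [CharZero K] (p : ℕ) (δ μ : K) (m : ℕ)
    (u : Verma p δ μ) : Prop :=
  0 < m ∧ u ∈ level p δ μ m ∧ u ≠ 0 ∧ ∀ X ∈ plus K p, toU X • u = 0

/-- The vector `(α μ C - P_{ℓ+1/2}^2)^q |δ, μ⟩` with `α = 2 ((ℓ-1/2)!)^2`. -/
noncomputable def singVec {K : Type*} [Field K] [CharZero K] (p : ℕ) (δ μ : K) (q : ℕ) :
    Verma p δ μ :=
  ((2 * (p.factorial : K) ^ 2 * μ) • toU (C K p) - toU (P K p (p + 1)) ^ 2) ^ q • hwv p δ μ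

end CGA

/-! Since `μ ≠ 0`, the `P_n` generate a Heisenberg algebra, and `C`, `D`, `H` act on it exactly as
the quadratic elements `oscC`, `oscD`, `oscH` do (`IsHeisenberg.quad_lie`). These quadratics form an
`sl₂`-triple of their own. The Verma module can therefore be modelled as an `sl₂` Verma module
tensored with a Fock space: `C`, `D`, `H` act as the sum of an abstract `sl₂`-triple and the
oscillator one, and the two triples commute. The zero-point value `-(p+1)²/2` of `oscD` on the
vacuum moves the `sl₂` highest weight to `d = δ + (p+1)²/2`.

In the model (`exists_verma_model`) a vector killed by `P_0, …, P_p` has constant polynomials as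
entries. The oscillator part of `H` kills constants, so what remains is an `sl₂` problem: the
grading by `D` leaves a single coordinate `q = m/2`, and `H` annihilates it only if `d = q - 1`.
This is `IsSingular.map_model`. Sums of kets of one level map injectively to the model
(`ketSum_injective_of_model`), which turns this into uniqueness in the Verma module.

For existence, `oscC` acts on vacuum vectors as `P_{p+1}²/(αμ)`, with `α = 2 (p!)²`, so `αμC -
P_{p+1}²` is `αμ` times the pure `sl₂` raising operator there. Its powers are checked to be singular
directly in the enveloping algebra (`P_smul_singVec`, `H_smul_singVec_succ`); the model shows that
they do not vanish. -/

namespace CGA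

attribute [local instance] LieRing.ofAssociativeRing

set_option linter.unusedSectionVars false

/-! ### Identities for the structure constants -/

section StructI

variable (K : Type*) [Field K] (p : ℕ)

theorem structI_ne_zero [CharZero K] (m : ℕ) : structI K p m ≠ 0 := by
  simp [structI, Nat.factorial_ne_zero]

theorem structI_reflect {m n : ℕ} (h : m + n = 2 * p + 1) :
    structI K p m = -structI K p n := by
  have e1 : 2 * p + 1 - m = n := by omega
  have e2 : 2 * p + 1 - n = m := by omega
  have e3 : (-1 : K) ^ (m + p + 1) = -(-1) ^ (n + p + 1) := by
    rcases Nat.even_or_odd (n + p + 1) with he | he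
    · have ho : Odd (m + p + 1) := by grind
      rw [he.neg_one_pow, ho.neg_one_pow]
    · have ho : Even (m + p + 1) := by grind
      rw [he.neg_one_pow, ho.neg_one_pow]; simp
  simp only [structI, e1, e2, e3]
  ring

/-- This single identity expresses the invariance of the symplectic form on the `P_n` under both `C`
and `H`. -/
theorem structI_succ {m n : ℕ} (h : m + n = 2 * p) :
    (n + 1 : K) * structI K p (m + 1) = -((m + 1 : K) * structI K p m) := by
  have e1 : 2 * p + 1 - m = n + 1 := by omega
  have e2 : 2 * p + 1 - (m + 1) = n := by omega
  simp only [structI, e1, e2, Nat.factorial_succ]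
  push_cast
  ring

/-- The pairing of `P_p` with `P_{p+1}` is the origin of the constant `α = 2 (p!)²`. -/
theorem structI_mid : structI K p p = -((p + 1 : K) * (p.factorial : K) ^ 2) := by
  have e1 : 2 * p + 1 - p = p + 1 := by omega
  have e2 : Odd (p + p + 1) := by grind
  simp only [structI, e1, e2.neg_one_pow, Nat.factorial_succ]
  push_cast
  ring

end StructI

/-! ### Commutator calculus in associative algebras -/

theorem lie_mul_right {A : Type*} [Ring A] (x a b : A) : ⁅x, a * b⁆ = ⁅x, a⁆ * b + a * ⁅x, b⁆ := by
  simp only [Ring.lie_def]; noncomm_ring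

theorem lie_mul_left {A : Type*} [Ring A] (x a b : A) : ⁅a * b, x⁆ = a * ⁅b, x⁆ + ⁅a, x⁆ * b := by
  simp only [Ring.lie_def]; noncomm_ring

section Commutator

variable {K : Type*} [CommRing K] {A : Type*} [Ring A] [Algebra K A]

theorem lie_smul_right (t : K) (x y : A) : ⁅x, t • y⁆ = t • ⁅x, y⁆ := by
  simp only [Ring.lie_def, mul_smul_comm, smul_mul_assoc, smul_sub]

theorem smul_lie_left (t : K) (x y : A) : ⁅t • x, y⁆ = t • ⁅x, y⁆ := by
  simp only [Ring.lie_def, mul_smul_comm, smul_mul_assoc, smul_sub]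

theorem lie_sum_right {ι : Type*} (s : Finset ι) (f : ι → A) (x : A) :
    ⁅x, ∑ i ∈ s, f i⁆ = ∑ i ∈ s, ⁅x, f i⁆ := by
  simp only [Ring.lie_def, Finset.mul_sum, Finset.sum_mul, Finset.sum_sub_distrib]

theorem sum_lie_left {ι : Type*} (s : Finset ι) (f : ι → A) (x : A) :
    ⁅∑ i ∈ s, f i, x⁆ = ∑ i ∈ s, ⁅f i, x⁆ := by
  simp only [Ring.lie_def, Finset.mul_sum, Finset.sum_mul, Finset.sum_sub_distrib]

end Commutator

/-! ### The oscillator realization of `sl₂` by quadratic elements -/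

section Oscillator

variable {K : Type*} [Field K] [CharZero K] {A : Type*} [Ring A] [Algebra K A]

/-- A family of elements of an associative algebra satisfying the commutation relations of the
`P_n`, with the central element acting by the scalar `μ`. -/
structure IsHeisenberg (p : ℕ) (μ : K) (π : ℕ → A) : Prop where
  zero : ∀ n, 2 * p + 2 ≤ n → π n = 0
  comm : ∀ m n, ⁅π m, π n⁆ =
    if m + n = 2 * p + 1 then algebraMap K A (structI K p m * μ) else 0

/-- The family dual to `π` with respect to the commutator. -/
noncomputable def dualP (p : ℕ) (μ : K) (π : ℕ → A) (n : ℕ) : A :=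
  (structI K p n * μ)⁻¹ • π (2 * p + 1 - n)

/-- The element quadratic in `π` that implements `π n ↦ s n • π (e n)`. -/
noncomputable def quad (p : ℕ) (μ : K) (π : ℕ → A) (s : ℕ → K) (e : ℕ → ℕ) : A :=
  (-(1 / 2) : K) • ∑ n ∈ Finset.range (2 * p + 2), s n • (π (e n) * dualP p μ π n)

variable {p : ℕ} {μ : K} {π : ℕ → A}

namespace IsHeisenberg

theorem lie_dualP (hπ : IsHeisenberg p μ π) (hμ : μ ≠ 0) {m n : ℕ} (hn : n < 2 * p + 2) :
    ⁅π m, dualP p μ π n⁆ = if m = n then 1 else 0 := by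
  rw [dualP, lie_smul_right, hπ.comm]
  by_cases h : m = n
  · subst h
    rw [if_pos (by omega), if_pos rfl, Algebra.algebraMap_eq_smul_one, smul_smul,
      inv_mul_cancel₀ (mul_ne_zero (structI_ne_zero K p m) hμ), one_smul]
  · rw [if_neg (by omega), if_neg h, smul_zero]

theorem dualP_lie (hπ : IsHeisenberg p μ π) (hμ : μ ≠ 0) {m n : ℕ} (hn : n < 2 * p + 2) :
    ⁅dualP p μ π n, π m⁆ = if m = n then -1 else 0 := by
  rw [← lie_skew, hπ.lie_dualP hμ hn]
  split_ifs <;> simp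

/-- Expansion of `π k` in the dual family; only the index `2p + 1 - k` contributes. -/
theorem sum_lie_dualP (hπ : IsHeisenberg p μ π) (hμ : μ ≠ 0) (k : ℕ) :
    ∑ n ∈ Finset.range (2 * p + 2), ⁅π n, π k⁆ * dualP p μ π n = π k := by
  by_cases hk : k < 2 * p + 2
  · rw [Finset.sum_eq_single (2 * p + 1 - k)]
    · rw [hπ.comm, if_pos (by omega), ← Algebra.smul_def, dualP, smul_smul,
        mul_inv_cancel₀ (mul_ne_zero (structI_ne_zero K p _) hμ), one_smul]
      congr 1; omega
    · intro n hn h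
      rw [hπ.comm, if_neg (by simp at hn; omega), zero_mul]
    · intro h; simp at h; omega
  · simp [hπ.zero k (by omega)]

/-- The Leibniz rule gives two sums. One collapses by duality; in the other, `hinv` (the map is
infinitesimally symplectic) moves the map onto `π m`, and `sum_lie_dualP` evaluates it. Both equal
`-s m • π (e m)`, which explains the factor `-1/2` in `quad`. -/
theorem quad_lie (hπ : IsHeisenberg p μ π) (hμ : μ ≠ 0) {s : ℕ → K} {e : ℕ → ℕ}
    (hinv : ∀ n m, n < 2 * p + 2 → m < 2 * p + 2 →
      s n • ⁅π (e n), π m⁆ = -(s m • ⁅π n, π (e m)⁆)) {m : ℕ} (hm : m < 2 * p + 2) :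
    ⁅quad p μ π s e, π m⁆ = s m • π (e m) := by
  have h1 : ∀ n ∈ Finset.range (2 * p + 2), ⁅s n • (π (e n) * dualP p μ π n), π m⁆ =
      (if m = n then -(s m • π (e m)) else 0) - s m • (⁅π n, π (e m)⁆ * dualP p μ π n) := by
    intro n hn
    rw [Finset.mem_range] at hn
    rw [smul_lie_left, lie_mul_left, hπ.dualP_lie hμ hn, smul_add, ← smul_mul_assoc _ ⁅_, _⁆,
      hinv n m hn hm, neg_mul, smul_mul_assoc, ← sub_eq_add_neg]
    congr 1
    split_ifs with h
    · subst h; simp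
    · simp
  rw [quad, smul_lie_left, sum_lie_left, Finset.sum_congr rfl h1, Finset.sum_sub_distrib,
    Finset.sum_ite_eq, if_pos (Finset.mem_range.2 hm), ← Finset.smul_sum, hπ.sum_lie_dualP hμ]
  module

end IsHeisenberg

/-- The oscillator realization of `C`. -/
noncomputable def oscC (p : ℕ) (μ : K) (π : ℕ → A) : A :=
  quad p μ π (fun n => (2 * p + 1 : K) - n) fun n => n + 1

/-- The oscillator realization of `H`. -/
noncomputable def oscH (p : ℕ) (μ : K) (π : ℕ → A) : A :=
  quad p μ π (fun n => -(n : K)) fun n => n - 1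

/-- The oscillator realization of `D`. -/
noncomputable def oscD (p : ℕ) (μ : K) (π : ℕ → A) : A :=
  quad p μ π (fun n => (2 * p + 1 : K) - 2 * n) fun n => n

namespace IsHeisenberg

theorem oscC_lie (hπ : IsHeisenberg p μ π) (hμ : μ ≠ 0) {m : ℕ} (hm : m < 2 * p + 2) :
    ⁅oscC p μ π, π m⁆ = ((2 * p + 1 : K) - m) • π (m + 1) := by
  refine hπ.quad_lie hμ (fun n m hn hm => ?_) hm
  simp only [hπ.comm]
  by_cases h : n + m = 2 * p
  · rw [if_pos (by omega), if_pos (by omega), Algebra.smul_def, Algebra.smul_def, ← map_mul,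
      ← map_mul, ← map_neg]
    have h' : (n : K) + m = 2 * p := by exact_mod_cast h
    have := structI_succ K p h
    congr 1
    rw [show (2 * p + 1 : K) - n = m + 1 by linear_combination -h',
      show (2 * p + 1 : K) - m = n + 1 by linear_combination -h']
    linear_combination μ * this
  · rw [if_neg (by omega), if_neg (by omega)]; simp

theorem oscH_lie (hπ : IsHeisenberg p μ π) (hμ : μ ≠ 0) {m : ℕ} (hm : m < 2 * p + 2) :
    ⁅oscH p μ π, π m⁆ = -((m : K) • π (m - 1)) := by
  rw [← neg_smul]
  refine hπ.quad_lie hμ (fun n m hn hm => ?_) hm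
  simp only [hπ.comm]
  rcases n with _ | n
  · rcases m with _ | m
    · simp
    · rw [if_neg (c := 0 + (m + 1 - 1) = 2 * p + 1) (by omega)]; simp
  rcases m with _ | m
  · rw [if_neg (c := n + 1 - 1 + 0 = 2 * p + 1) (by omega)]; simp
  by_cases h : n + m = 2 * p
  · rw [if_pos (by omega), if_pos (by omega), Algebra.smul_def, Algebra.smul_def, ← map_mul,
      ← map_mul, ← map_neg]
    have := structI_succ K p h
    congr 1
    rw [Nat.add_sub_cancel]
    push_cast
    linear_combination -μ * this
  · rw [if_neg (by omega), if_neg (by omega)]; simp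

theorem oscD_lie (hπ : IsHeisenberg p μ π) (hμ : μ ≠ 0) {m : ℕ} (hm : m < 2 * p + 2) :
    ⁅oscD p μ π, π m⁆ = ((2 * p + 1 : K) - 2 * m) • π m := by
  refine hπ.quad_lie hμ (fun n m hn hm => ?_) hm
  simp only [hπ.comm]
  split_ifs with h
  · have h' : (n : K) + m = 2 * p + 1 := by exact_mod_cast h
    rw [Algebra.smul_def, Algebra.smul_def, ← map_mul, ← map_mul, ← map_neg]
    congr 1
    linear_combination (-2 * structI K p n * μ) * h'
  · simp

theorem oscD_lie_dualP (hπ : IsHeisenberg p μ π) (hμ : μ ≠ 0) {m : ℕ} (hm : m < 2 * p + 2) :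
    ⁅oscD p μ π, dualP p μ π m⁆ = -(((2 * p + 1 : K) - 2 * m) • dualP p μ π m) := by
  rw [dualP, lie_smul_right, hπ.oscD_lie hμ (by omega), Nat.cast_sub (by omega)]
  push_cast
  module

theorem oscC_lie_dualP_succ (hπ : IsHeisenberg p μ π) (hμ : μ ≠ 0) {m : ℕ}
    (hm : m + 1 < 2 * p + 2) :
    ⁅oscC p μ π, dualP p μ π (m + 1)⁆ = -(((2 * p + 1 : K) - m) • dualP p μ π m) := by
  obtain ⟨n, hn⟩ : ∃ n, m + n = 2 * p := ⟨2 * p - m, by omega⟩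
  have h := structI_succ K p hn
  have h' : (m : K) + n = 2 * p := by exact_mod_cast hn
  have h1 := structI_ne_zero K p m
  have h2 := structI_ne_zero K p (m + 1)
  have h3 : (m + 1 : K) ≠ 0 := Nat.cast_add_one_ne_zero m
  rw [dualP, dualP, lie_smul_right, hπ.oscC_lie hμ (by omega),
    show 2 * p + 1 - (m + 1) + 1 = 2 * p + 1 - m by omega, smul_smul, smul_smul, ← neg_smul,
    show 2 * p + 1 - (m + 1) = n by omega]
  congr 1
  rw [show (2 * p + 1 : K) - n = m + 1 by linear_combination -h',
      show (2 * p + 1 : K) - m = n + 1 by linear_combination -h']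
  field_simp
  linear_combination h

/-- Every summand is an eigenvector of `oscD`: the weights of `π (n + 1)` and of the dual of `π n`
add up to `-2`. At `n = 2p + 1` the summand is zero because `π (2p + 2)` is. -/
theorem oscD_lie_oscC (hπ : IsHeisenberg p μ π) (hμ : μ ≠ 0) :
    ⁅oscD p μ π, oscC p μ π⁆ = -((2 : K) • oscC p μ π) := by
  have h1 : ∀ n ∈ Finset.range (2 * p + 2),
      ⁅oscD p μ π, ((2 * p + 1 : K) - n) • (π (n + 1) * dualP p μ π n)⁆ =
      (-2 : K) • (((2 * p + 1 : K) - n) • (π (n + 1) * dualP p μ π n)) := by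
    intro n hn
    rw [Finset.mem_range] at hn
    by_cases h : n + 1 < 2 * p + 2
    · rw [lie_smul_right, lie_mul_right, hπ.oscD_lie hμ h, hπ.oscD_lie_dualP hμ hn, mul_neg,
        mul_smul_comm, smul_mul_assoc]
      push_cast
      module
    · simp [hπ.zero _ (not_lt.1 h)]
  rw [oscC, quad, lie_smul_right, lie_sum_right, Finset.sum_congr rfl h1, ← Finset.smul_sum]
  module

theorem oscD_lie_oscH (hπ : IsHeisenberg p μ π) (hμ : μ ≠ 0) :
    ⁅oscD p μ π, oscH p μ π⁆ = (2 : K) • oscH p μ π := by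
  have h1 : ∀ n ∈ Finset.range (2 * p + 2),
      ⁅oscD p μ π, (-(n : K)) • (π (n - 1) * dualP p μ π n)⁆ =
      (2 : K) • ((-(n : K)) • (π (n - 1) * dualP p μ π n)) := by
    intro n hn
    rw [Finset.mem_range] at hn
    rcases n with _ | n
    · simp
    · rw [lie_smul_right, lie_mul_right, hπ.oscD_lie hμ (by omega), hπ.oscD_lie_dualP hμ hn, mul_neg,
        mul_smul_comm, smul_mul_assoc, Nat.add_sub_cancel]
      push_cast
      module
  rw [oscH, quad, lie_smul_right, lie_sum_right, Finset.sum_congr rfl h1, ← Finset.smul_sum]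
  module

/-- The commutator is a difference of two diagonal sums, shifted by one index against each other.
Extending both to the full range adds only zero terms, and the coefficients subtract to
`(n+1)(2p+1-n) - n(2p+2-n) = 2p+1-2n`, those of `oscD`. -/
theorem oscC_lie_oscH (hπ : IsHeisenberg p μ π) (hμ : μ ≠ 0) :
    ⁅oscC p μ π, oscH p μ π⁆ = oscD p μ π := by
  have h0 : ⁅oscC p μ π, (-((0 : ℕ) : K)) • (π (0 - 1) * dualP p μ π 0)⁆ = 0 := by simp
  have h1 : ∀ n ∈ Finset.range (2 * p + 1),
      ⁅oscC p μ π, (-((n + 1 : ℕ) : K)) • (π (n + 1 - 1) * dualP p μ π (n + 1))⁆ =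
      ((n + 1 : K) * ((2 * p + 1 : K) - n)) • (π n * dualP p μ π n) -
      ((n + 1 : K) * ((2 * p + 1 : K) - n)) • (π (n + 1) * dualP p μ π (n + 1)) := by
    intro n hn
    rw [Finset.mem_range] at hn
    rw [lie_smul_right, lie_mul_right, Nat.add_sub_cancel, hπ.oscC_lie hμ (by omega),
      hπ.oscC_lie_dualP_succ hμ (by omega), mul_neg, mul_smul_comm, smul_mul_assoc]
    push_cast
    module
  have h2 : ∑ n ∈ Finset.range (2 * p + 1),
      ((n + 1 : K) * ((2 * p + 1 : K) - n)) • (π (n + 1) * dualP p μ π (n + 1)) =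
      ∑ n ∈ Finset.range (2 * p + 2),
      ((n : K) * ((2 * p + 1 : K) - n + 1)) • (π n * dualP p μ π n) := by
    rw [Finset.sum_range_succ' _ (2 * p + 1)]
    simp only [Nat.cast_zero, zero_mul, zero_smul, add_zero]
    refine Finset.sum_congr rfl fun n _ => ?_
    push_cast
    congr 1
    ring
  have h3 : ∑ n ∈ Finset.range (2 * p + 1),
      ((n + 1 : K) * ((2 * p + 1 : K) - n)) • (π n * dualP p μ π n) =
      ∑ n ∈ Finset.range (2 * p + 2),
      ((n + 1 : K) * ((2 * p + 1 : K) - n)) • (π n * dualP p μ π n) := by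
    rw [Finset.sum_range_succ _ (2 * p + 1)]
    simp
  rw [oscH, quad, lie_smul_right, lie_sum_right, Finset.sum_range_succ', h0, add_zero,
    Finset.sum_congr rfl h1, Finset.sum_sub_distrib, h2, h3, ← Finset.sum_sub_distrib, oscD, quad]
  congr 1
  refine Finset.sum_congr rfl fun n _ => ?_
  rw [← sub_smul]
  congr 1
  ring

end IsHeisenberg

end Oscillator

/-! ### The quadratic elements on vectors killed by `P_0, …, P_p` -/

section Vacuum

variable {K : Type*} [Field K] [CharZero K] {W : Type*} [AddCommGroup W] [Module K W]
  {p : ℕ} {μ : K} {π : ℕ → Module.End K W}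

theorem dualP_apply (n : ℕ) (f : W) :
    dualP p μ π n f = (structI K p n * μ)⁻¹ • π (2 * p + 1 - n) f := rfl

theorem quad_apply (s : ℕ → K) (e : ℕ → ℕ) (f : W) :
    quad p μ π s e f = (-(1 / 2) : K) •
      ∑ n ∈ Finset.range (2 * p + 2), s n • π (e n) (dualP p μ π n f) := by
  simp [quad]

namespace IsHeisenberg

theorem comm_apply (hπ : IsHeisenberg p μ π) {m n : ℕ} (h : m + n ≠ 2 * p + 1) (f : W) :
    π m (π n f) = π n (π m f) := by
  have h1 := congrArg (fun T : Module.End K W => T f) (hπ.comm m n)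
  rw [if_neg h] at h1
  simpa [Ring.lie_def, sub_eq_zero] using h1

/-- Both factors of a nonzero summand have index sum `2p`, so they commute and one of them has index
at most `p`. -/
theorem oscH_vacuum (hπ : IsHeisenberg p μ π) {f : W} (hf : ∀ n ≤ p, π n f = 0) :
    oscH p μ π f = 0 := by
  rw [oscH, quad_apply, Finset.sum_eq_zero, smul_zero]
  intro n hn
  rw [Finset.mem_range] at hn
  rw [dualP_apply, map_smul]
  rcases Nat.lt_or_ge p n with h | h
  · rw [hf _ (by omega)]; simp
  · rcases n with _ | n
    · simp
    · rw [hπ.comm_apply (by omega), hf _ (by omega)]; simp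

/-- The index sum is now `2p + 2`, so the only summand without an annihilating factor is `n = p`,
where both indices are `p + 1`. -/
theorem oscC_vacuum (hπ : IsHeisenberg p μ π) (hμ : μ ≠ 0) {f : W} (hf : ∀ n ≤ p, π n f = 0) :
    (2 * (p.factorial : K) ^ 2 * μ) • oscC p μ π f = π (p + 1) (π (p + 1) f) := by
  have h1 : (p + 1 : K) ≠ 0 := Nat.cast_add_one_ne_zero p
  have h2 : (p.factorial : K) ≠ 0 := Nat.cast_ne_zero.2 p.factorial_ne_zero
  rw [oscC, quad_apply, Finset.sum_eq_single p]
  · rw [dualP_apply, map_smul, smul_smul, smul_smul, smul_smul, structI_mid,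
      show 2 * p + 1 - p = p + 1 by omega]
    convert one_smul K _ using 2
    rw [show (2 * p + 1 : K) - p = p + 1 by ring]
    field_simp
  · intro n hn hnp
    rw [Finset.mem_range] at hn
    rw [dualP_apply, map_smul]
    rcases Nat.lt_or_ge p n with h | h
    · rw [hf _ (by omega)]; simp
    · rw [hπ.comm_apply (by omega), hf (n + 1) (by omega)]; simp
  · intro h
    simp at h
    omega

/-- The zero-point energy: the summands with `n ≤ p` return `f` by the canonical relation, the
others vanish, and the first `p + 1` weights add up to `(p+1)²`. This is the source of `(ℓ + 1/2)²`
in the singularity condition. -/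
theorem oscD_vacuum (hπ : IsHeisenberg p μ π) (hμ : μ ≠ 0) {f : W} (hf : ∀ n ≤ p, π n f = 0) :
    oscD p μ π f = (-((p + 1 : K) ^ 2 / 2)) • f := by
  have h1 : ∀ n ∈ Finset.range (p + 1), π n (dualP p μ π n f) = f := by
    intro n hn
    rw [Finset.mem_range] at hn
    have h := congrArg (fun T : Module.End K W => T f)
      (hπ.lie_dualP hμ (m := n) (n := n) (by omega))
    simpa [Ring.lie_def, hf n (by omega)] using h
  have h2 : ∀ n ∈ Finset.range (2 * p + 2), n ∉ Finset.range (p + 1) →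
      ((2 * p + 1 : K) - 2 * n) • π n (dualP p μ π n f) = 0 := by
    intro n _ hn
    rw [Finset.mem_range] at hn
    rw [dualP_apply, hf _ (by omega)]; simp
  have h3 : ∀ q : ℕ, ∑ n ∈ Finset.range q, ((2 * p + 1 : K) - 2 * n) = q * (2 * p + 2 - q) := by
    intro q
    induction q with
    | zero => simp
    | succ q ih => rw [Finset.sum_range_succ, ih]; push_cast; ring
  rw [oscD, quad_apply, ← Finset.sum_subset (Finset.range_mono (by omega)) h2,
    Finset.sum_congr rfl fun n hn => by rw [h1 n hn], ← Finset.sum_smul, h3, smul_smul]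
  congr 1
  push_cast
  ring

end IsHeisenberg

end Vacuum

/-! ### Representations of the enveloping algebra from generators and relations -/

section Representation

variable {K : Type*} [Field K] [CharZero K] {A : Type*} [Ring A] [Algebra K A]

/-- Elements of an associative algebra satisfying the defining relations define a
representation of the enveloping algebra. -/
theorem exists_algHom {p : ℕ} {μ : K} {π : ℕ → A} (hπ : IsHeisenberg p μ π) {c d h : A}
    (hdh : ⁅d, h⁆ = (2 : K) • h) (hdc : ⁅d, c⁆ = -((2 : K) • c)) (hch : ⁅c, h⁆ = d)
    (hh : ∀ n < 2 * p + 2, ⁅h, π n⁆ = -((n : K) • π (n - 1)))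
    (hd : ∀ n < 2 * p + 2, ⁅d, π n⁆ = ((2 * p + 1 : K) - 2 * n) • π n)
    (hc : ∀ n < 2 * p + 2, ⁅c, π n⁆ = ((2 * p + 1 : K) - n) • π (n + 1)) :
    ∃ L : U K p →ₐ[K] A, L (toU (C K p)) = c ∧ L (toU (D K p)) = d ∧ L (toU (H K p)) = h ∧
      L (toU (M K p)) = algebraMap K A μ ∧ ∀ n, L (toU (P K p n)) = π n := by
  let g : CGAGen p → A
    | .C => c
    | .D => d
    | .H => h
    | .M => algebraMap K A μ
    | .P n => π n
  let f : CGA K p →ₗ[K] A := (Finsupp.linearCombination K g : (CGAGen p →₀ K) →ₗ[K] A)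
  have fg : ∀ a, f (gen K a) = g a := fun a => by
    show (Finsupp.linearCombination K g) (Finsupp.single a 1) = _
    simp
  have fC : f (C K p) = c := fg .C
  have fD : f (D K p) = d := fg .D
  have fH : f (H K p) = h := fg .H
  have fM : f (M K p) = algebraMap K A μ := fg .M
  have fP : ∀ n, f (P K p n) = π n := fun n => by
    by_cases hn : n < 2 * p + 2
    · rw [← P_val K p ⟨n, hn⟩]; exact fg _
    · rw [P_of_ge K p n (by omega), hπ.zero n (by omega), map_zero]
  have lieM : ∀ x : A, ⁅algebraMap K A μ, x⁆ = 0 := fun x => by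
    rw [Ring.lie_def, Algebra.commutes, sub_self]
  have Mlie : ∀ x : A, ⁅x, algebraMap K A μ⁆ = 0 := fun x => by
    rw [Ring.lie_def, Algebra.commutes, sub_self]
  have hgen : ∀ a b, f (genBracket K p a b) = ⁅g a, g b⁆ := by
    have hhd : ⁅h, d⁆ = -((2 : K) • h) := by rw [← lie_skew, hdh]
    have hcd : ⁅c, d⁆ = (2 : K) • c := by rw [← lie_skew, hdc, neg_neg]
    have hhc : ⁅h, c⁆ = -d := by rw [← lie_skew, hch]
    have hh' : ∀ n : Fin (2 * p + 2), ⁅π n, h⁆ = ((n : ℕ) : K) • π (n - 1) := fun n => by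
      rw [← lie_skew, hh n n.2, neg_neg]
    have hd' : ∀ n : Fin (2 * p + 2), ⁅π n, d⁆ = -(((2 * p + 1 : K) - 2 * (n : ℕ)) • π n) :=
      fun n => by rw [← lie_skew, hd n n.2]
    have hc' : ∀ n : Fin (2 * p + 2), ⁅π n, c⁆ = -(((2 * p + 1 : K) - (n : ℕ)) • π (n + 1)) :=
      fun n => by rw [← lie_skew, hc n n.2]
    intro a b
    rcases a with _ | _ | _ | _ | m <;> rcases b with _ | _ | _ | _ | n <;>
      simp only [genBracket, g, map_zero, map_neg, map_smul, fC, fD, fH, fP, lieM, Mlie, lie_self,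
        hdh, hdc, hch, hhd, hcd, hhc, hh', hd', hc', hh _ (Fin.is_lt _), hd _ (Fin.is_lt _),
        hc _ (Fin.is_lt _), hπ.comm]
    split_ifs
    · rw [map_smul, fM, map_mul, Algebra.smul_def]
    · simp
  have hlie : ∀ x y, f (bracket K p x y) = ⁅f x, f y⁆ := by
    intro x y
    induction x using induction_gen with
    | h0 => simp
    | hadd x x' h h' => simp [h, h', add_lie]
    | hs s a =>
      induction y using induction_gen with
      | h0 => simp
      | hadd y y' h h' => simp only [map_add, h, h', lie_add]
      | hs t b =>
        simp only [map_smul, LinearMap.smul_apply, bracket_gen, hgen, fg, smul_lie_left, lie_smul_right]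
  let F : CGA K p →ₗ⁅K⁆ A := { f with map_lie' := fun {x y} => hlie x y }
  refine ⟨UniversalEnvelopingAlgebra.lift K F, ?_, ?_, ?_, ?_, fun n => ?_⟩ <;>
    rw [UniversalEnvelopingAlgebra.lift_ι_apply]
  exacts [fC, fD, fH, fM, fP n]

end Representation

/-! ### Transport of the oscillator construction along algebra homomorphisms -/

section Map

variable {K : Type*} [Field K] [CharZero K] {A B : Type*} [Ring A] [Algebra K A] [Ring B]
  [Algebra K B] {p : ℕ} {μ : K} {π : ℕ → A}

theorem IsHeisenberg.map (hπ : IsHeisenberg p μ π) (F : A →ₐ[K] B) :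
    IsHeisenberg p μ fun n => F (π n) where
  zero n hn := by rw [hπ.zero n hn, map_zero]
  comm m n := by
    have h := congrArg F (hπ.comm m n)
    rw [Ring.lie_def, map_sub, map_mul, map_mul] at h
    rw [Ring.lie_def, h]
    split_ifs <;> simp

theorem quad_map (F : A →ₐ[K] B) (s : ℕ → K) (e : ℕ → ℕ) :
    quad p μ (fun n => F (π n)) s e = F (quad p μ π s e) := by
  simp [quad, dualP, map_sum]

end Map

/-! ### The Fock space -/

section Fock

variable {K : Type*} [Field K] [CharZero K]

/-- The Fock representation of the `P_n` by differential operators on polynomials. -/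
noncomputable def fockP (p : ℕ) (μ : K) (n : ℕ) : Module.End K (MvPolynomial (Fin (p + 1)) K) :=
  -- The variable `X j` stands for `P_{p+1+j}`. The partner of `P_n` is `P_{2p+1-n}`, hence
  -- differentiation in the variable of index `p - n`.
  if n ≤ p then
    (structI K p n * μ) • (MvPolynomial.pderiv (⟨p - n, by omega⟩ : Fin (p + 1))).toLinearMap
  else if h : n < 2 * p + 2 then
    Algebra.lmul K _ (MvPolynomial.X (⟨n - (p + 1), by omega⟩ : Fin (p + 1)))
  else 0

variable {p : ℕ} {μ : K}

theorem fockP_of_le {n : ℕ} (h : n ≤ p) (f : MvPolynomial (Fin (p + 1)) K) :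
    fockP p μ n f = (structI K p n * μ) • MvPolynomial.pderiv ⟨p - n, by omega⟩ f := by
  simp [fockP, h]

theorem fockP_of_lt {n : ℕ} (h : ¬ n ≤ p) (h' : n < 2 * p + 2)
    (f : MvPolynomial (Fin (p + 1)) K) :
    fockP p μ n f = MvPolynomial.X ⟨n - (p + 1), by omega⟩ * f := by
  simp [fockP, h, h']

theorem fockP_of_ge {n : ℕ} (h : 2 * p + 2 ≤ n) : fockP p μ n = 0 := by
  rw [fockP, if_neg (by omega), dif_neg (by omega)]

theorem fockP_add (j : Fin (p + 1)) :
    fockP p μ (p + 1 + j) = Algebra.lmul K _ (MvPolynomial.X j) := by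
  have := j.2
  rw [fockP, if_neg (by omega), dif_pos (by omega)]
  simp

/-- The commutator of two derivations is a derivation, so it suffices that it vanish on the
variables. -/
theorem pderiv_comm {σ : Type*} (i j : σ) (f : MvPolynomial σ K) :
    MvPolynomial.pderiv i (MvPolynomial.pderiv j f) =
      MvPolynomial.pderiv j (MvPolynomial.pderiv i f) := by
  classical
  have h : ⁅MvPolynomial.pderiv (R := K) i, MvPolynomial.pderiv (R := K) j⁆ = 0 := by
    refine MvPolynomial.derivation_ext fun k => ?_
    rw [Derivation.commutator_apply, MvPolynomial.pderiv_X, MvPolynomial.pderiv_X]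
    simp [Pi.single_apply, apply_ite]
  rw [← sub_eq_zero, ← Derivation.commutator_apply, h, Derivation.zero_apply]

theorem fockP_isHeisenberg (p : ℕ) (μ : K) : IsHeisenberg p μ (fockP p μ) where
  zero _ := fockP_of_ge
  comm m n := by
    have key : ∀ m n, m ≤ p → ¬ n ≤ p → n < 2 * p + 2 → ⁅fockP p μ m, fockP p μ n⁆ =
        if m + n = 2 * p + 1 then
          algebraMap K (Module.End K (MvPolynomial (Fin (p + 1)) K)) (structI K p m * μ)
        else 0 := by
      intro m n hm hn hn'
      refine LinearMap.ext fun f => ?_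
      rw [Ring.lie_def, LinearMap.sub_apply, Module.End.mul_apply, Module.End.mul_apply,
        fockP_of_lt hn hn', fockP_of_lt hn hn', fockP_of_le hm, fockP_of_le hm, Derivation.leibniz,
        MvPolynomial.pderiv_X]
      split_ifs with h
      · have e : (⟨n - (p + 1), by omega⟩ : Fin (p + 1)) = ⟨p - m, by omega⟩ := by
          ext; simp; omega
        rw [e, Pi.single_eq_same]
        simp only [smul_eq_mul, mul_one, smul_add, mul_smul_comm, add_sub_cancel_left,
          Module.algebraMap_end_apply]
      · rw [Pi.single_eq_of_ne (by intro h'; simp at h'; omega)]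
        simp
    by_cases hm' : m < 2 * p + 2
    swap
    · rw [fockP_of_ge (by omega), zero_lie, if_neg (by omega)]
    by_cases hn' : n < 2 * p + 2
    swap
    · rw [fockP_of_ge (n := n) (by omega), lie_zero, if_neg (by omega)]
    by_cases hm : m ≤ p <;> by_cases hn : n ≤ p
    · rw [if_neg (by omega), Ring.lie_def, sub_eq_zero]
      refine LinearMap.ext fun f => ?_
      rw [Module.End.mul_apply, Module.End.mul_apply, fockP_of_le hn, fockP_of_le hm,
        fockP_of_le hm, fockP_of_le hn, Derivation.map_smul, Derivation.map_smul, smul_comm,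
        pderiv_comm]
    · exact key m n hm hn hn'
    · rw [← lie_skew, key n m hn hm hm', add_comm n m]
      split_ifs with h
      · rw [← map_neg, structI_reflect K p h, neg_mul]
      · exact neg_zero
    · rw [if_neg (by omega), Ring.lie_def, sub_eq_zero]
      refine LinearMap.ext fun f => ?_
      rw [Module.End.mul_apply, Module.End.mul_apply, fockP_of_lt hn hn', fockP_of_lt hm hm',
        fockP_of_lt hn hn', fockP_of_lt hm hm', mul_left_comm]

/-- A polynomial with vanishing partial derivatives is constant. -/
theorem eq_C_of_pderiv_eq_zero {σ : Type*} {f : MvPolynomial σ K}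
    (h : ∀ i, MvPolynomial.pderiv i f = 0) : ∃ a, f = MvPolynomial.C a := by
  classical
  refine ⟨f.coeff 0, MvPolynomial.ext _ _ fun s => ?_⟩
  rw [MvPolynomial.coeff_C]
  split_ifs with hs
  · rw [hs]
  · obtain ⟨i, hi⟩ : ∃ i, s i ≠ 0 := by
      by_contra! h'
      exact hs (Finsupp.ext fun i => (h' i).symm)
    -- This coefficient of the derivative is the coefficient of `f` at `s` times `s i`, which is
    -- invertible in characteristic zero.
    have h1 := congrArg (MvPolynomial.coeff (s - Finsupp.single i 1)) (h i)
    rw [MvPolynomial.coeff_pderiv, MvPolynomial.coeff_zero] at h1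
    have h2 : s - Finsupp.single i 1 + Finsupp.single i 1 = s :=
      tsub_add_cancel_of_le (by simpa [Finsupp.single_le_iff] using Nat.one_le_iff_ne_zero.2 hi)
    rw [h2] at h1
    exact (mul_eq_zero.1 h1).resolve_right (Nat.cast_add_one_ne_zero _)

end Fock

/-! ### The `sl₂` Verma module with coefficients in a vector space -/

section Sequences

variable {K : Type*} [Field K] {R : Type*} [AddCommGroup R] [Module K R]

/-- The coefficientwise action of operators on sequences. -/
def coeffwise (K R : Type*) [Field K] [AddCommGroup R] [Module K R] :
    Module.End K R →ₐ[K] Module.End K (ℕ → R) :=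
  AlgHom.ofLinearMap
    { toFun := fun T => T.compLeft ℕ
      map_add' := fun _ _ => rfl
      map_smul' := fun _ _ => rfl } rfl fun _ _ => rfl

theorem coeffwise_apply (T : Module.End K R) (f : ℕ → R) (n : ℕ) :
    coeffwise K R T f n = T (f n) := rfl

/-- The action of `C` on the Verma module of `sl₂`, in the basis of the `C ^ n`. -/
def raise (K R : Type*) [Field K] [AddCommGroup R] [Module K R] : Module.End K (ℕ → R) where
  toFun f n := Nat.casesOn n 0 f
  map_add' f g := by ext n; cases n <;> simp
  map_smul' c f := by ext n; cases n <;> simp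

/-- The action of `H` on the Verma module of `sl₂` of highest weight `d`. -/
def lower (R : Type*) [AddCommGroup R] [Module K R] (d : K) : Module.End K (ℕ → R) where
  toFun f n := (-((n + 1 : K) * (d - n))) • f (n + 1)
  map_add' f g := by ext n; simp
  map_smul' c f := by ext n; simp [smul_comm c]

/-- The action of `D` on the Verma module of `sl₂` of highest weight `d`. -/
def grade (R : Type*) [AddCommGroup R] [Module K R] (d : K) : Module.End K (ℕ → R) where
  toFun f n := (d - 2 * n : K) • f n
  map_add' f g := by ext n; simp
  map_smul' c f := by ext n; simp [smul_comm c]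

theorem raise_zero (f : ℕ → R) : raise K R f 0 = 0 := rfl

theorem raise_succ (f : ℕ → R) (n : ℕ) : raise K R f (n + 1) = f n := rfl

theorem lower_apply (d : K) (f : ℕ → R) (n : ℕ) :
    lower R d f n = (-((n + 1 : K) * (d - n))) • f (n + 1) := rfl

theorem grade_apply (d : K) (f : ℕ → R) (n : ℕ) : grade R d f n = (d - 2 * n : K) • f n := rfl

theorem grade_lie_lower (d : K) : ⁅grade R d, lower R d⁆ = (2 : K) • lower R d := by
  refine LinearMap.ext fun f => funext fun n => ?_
  simp only [Ring.lie_def, LinearMap.sub_apply, Module.End.mul_apply, LinearMap.smul_apply,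
    Pi.sub_apply, Pi.smul_apply, lower_apply, grade_apply]
  push_cast
  module

theorem grade_lie_raise (d : K) : ⁅grade R d, raise K R⁆ = -((2 : K) • raise K R) := by
  refine LinearMap.ext fun f => funext fun n => ?_
  simp only [Ring.lie_def, LinearMap.sub_apply, Module.End.mul_apply, LinearMap.smul_apply,
    Pi.sub_apply, Pi.smul_apply, LinearMap.neg_apply, Pi.neg_apply]
  cases n with
  | zero => simp [raise_zero, grade_apply]
  | succ n =>
    simp only [raise_succ, grade_apply]
    push_cast
    module

theorem raise_lie_lower (d : K) : ⁅raise K R, lower R d⁆ = grade R d := by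
  refine LinearMap.ext fun f => funext fun n => ?_
  simp only [Ring.lie_def, LinearMap.sub_apply, Module.End.mul_apply, Pi.sub_apply]
  cases n with
  | zero => simp [raise_zero, raise_succ, grade_apply, lower_apply]
  | succ n =>
    simp only [raise_succ, grade_apply, lower_apply]
    push_cast
    module

theorem commute_raise (T : Module.End K R) : Commute (raise K R) (coeffwise K R T) := by
  refine LinearMap.ext fun f => funext fun n => ?_
  cases n with
  | zero => exact (map_zero T).symm
  | succ n => rfl

theorem commute_lower (d : K) (T : Module.End K R) : Commute (lower R d) (coeffwise K R T) := by
  refine LinearMap.ext fun f => funext fun n => ?_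
  exact (map_smul T _ _).symm

theorem commute_grade (d : K) (T : Module.End K R) : Commute (grade R d) (coeffwise K R T) := by
  refine LinearMap.ext fun f => funext fun n => ?_
  exact (map_smul T _ _).symm

/-- Triangularity: `raise` moves the top coordinate up by one and `T` acts within coordinates, so
the leading term does not see `T`. -/
theorem raise_add_pow_single (T : Module.End K R) (r : R) (h : ℕ) :
    ((raise K R + coeffwise K R T) ^ h) (Pi.single 0 r) h = r ∧
      ∀ n, h < n → ((raise K R + coeffwise K R T) ^ h) (Pi.single 0 r) n = 0 := by
  induction h with
  | zero =>
    refine ⟨by simp, fun n hn => ?_⟩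
    rw [pow_zero, Module.End.one_apply, Pi.single_eq_of_ne hn.ne']
  | succ h ih =>
    have key : ∀ n, ((raise K R + coeffwise K R T) ^ (h + 1)) (Pi.single 0 r) (n + 1) =
        ((raise K R + coeffwise K R T) ^ h) (Pi.single 0 r) n +
          T (((raise K R + coeffwise K R T) ^ h) (Pi.single 0 r) (n + 1)) := by
      intro n
      rw [pow_succ', Module.End.mul_apply, LinearMap.add_apply, Pi.add_apply, raise_succ,
        coeffwise_apply]
    refine ⟨?_, fun n hn => ?_⟩
    · rw [key, ih.1, ih.2 _ (by omega), map_zero, add_zero]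
    · obtain ⟨n, rfl⟩ : ∃ k, n = k + 1 := ⟨n - 1, by omega⟩
      rw [key, ih.2 _ (by omega), ih.2 _ (by omega), map_zero, add_zero]

end Sequences

/-! ### The model of the Verma module -/

section Model

variable {K : Type*} [Field K] [CharZero K] {p : ℕ} {μ : K}

/-- The abstract triple commutes with every coefficientwise operator. Hence the mixed brackets of
the sums vanish, and the brackets with the `P_n` come from the oscillator part alone. -/
theorem exists_model (δ : K) (hμ : μ ≠ 0) :
    ∃ L : U K p →ₐ[K] Module.End K (ℕ → MvPolynomial (Fin (p + 1)) K),
      L (toU (C K p)) = raise K _ + coeffwise K _ (oscC p μ (fockP p μ)) ∧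
      L (toU (D K p)) = grade _ (δ + (p + 1) ^ 2 / 2) + coeffwise K _ (oscD p μ (fockP p μ)) ∧
      L (toU (H K p)) = lower _ (δ + (p + 1) ^ 2 / 2) + coeffwise K _ (oscH p μ (fockP p μ)) ∧
      L (toU (M K p)) = algebraMap K _ μ ∧
      ∀ n, L (toU (P K p n)) = coeffwise K _ (fockP p μ n) := by
  have hπ := (fockP_isHeisenberg p μ).map (coeffwise K _)
  have eC : oscC p μ (fun n => coeffwise K _ (fockP p μ n)) =
    coeffwise K _ (oscC p μ (fockP p μ)) := quad_map _ _ _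
  have eD : oscD p μ (fun n => coeffwise K _ (fockP p μ n)) =
    coeffwise K _ (oscD p μ (fockP p μ)) := quad_map _ _ _
  have eH : oscH p μ (fun n => coeffwise K _ (fockP p μ n)) =
    coeffwise K _ (oscH p μ (fockP p μ)) := quad_map _ _ _
  have hDH := hπ.oscD_lie_oscH hμ
  have hDC := hπ.oscD_lie_oscC hμ
  have hCH := hπ.oscC_lie_oscH hμ
  rw [eD, eH] at hDH
  rw [eD, eC] at hDC
  rw [eC, eH, eD] at hCH
  refine exists_algHom hπ ?_ ?_ ?_ (fun n hn => ?_) (fun n hn => ?_) fun n hn => ?_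
  · rw [add_lie, lie_add, lie_add, grade_lie_lower, hDH, (commute_grade _ _).lie_eq,
      (commute_lower _ _).symm.lie_eq, smul_add]
    abel
  · rw [add_lie, lie_add, lie_add, grade_lie_raise, hDC, (commute_grade _ _).lie_eq,
      (commute_raise _).symm.lie_eq, smul_add]
    abel
  · rw [add_lie, lie_add, lie_add, raise_lie_lower, hCH, (commute_raise _).lie_eq,
      (commute_lower _ _).symm.lie_eq]
    abel
  · rw [add_lie, (commute_lower _ _).lie_eq, zero_add, ← eH, hπ.oscH_lie hμ hn]
  · rw [add_lie, (commute_grade _ _).lie_eq, zero_add, ← eD, hπ.oscD_lie hμ hn]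
  · rw [add_lie, (commute_raise _).lie_eq, zero_add, ← eC, hπ.oscC_lie hμ hn]

/-- Universal property of the Verma module: the annihilator of `w` contains the generators of the
left ideal. -/
theorem exists_verma_lift {δ : K} {W : Type*} [AddCommGroup W] [Module K W]
    (L : U K p →ₐ[K] Module.End K W) (w : W) (hplus : ∀ X ∈ plus K p, L (toU X) w = 0)
    (hD : L (toU (D K p)) w = δ • w) (hM : L (toU (M K p)) w = μ • w) :
    ∃ F : Verma p δ μ →ₗ[K] W, F (hwv p δ μ) = w ∧ ∀ x u, F (x • u) = L x (F u) := by
  let _ : Module (U K p) W := Module.compHom W L.toRingHom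
  have hs : ∀ (x : U K p) (w : W), x • w = L x w := fun _ _ => rfl
  have : IsScalarTower K (U K p) W := ⟨fun c x w => by simp [hs]⟩
  have hker : vermaIdeal p δ μ ≤ LinearMap.ker (LinearMap.toSpanSingleton (U K p) W w) := by
    refine Submodule.span_le.2 ?_
    rintro x (⟨X, hX, rfl⟩ | rfl | rfl) <;>
      simp only [SetLike.mem_coe, LinearMap.mem_ker, LinearMap.toSpanSingleton_apply, hs]
    · exact hplus X hX
    · rw [map_sub, AlgHom.commutes, LinearMap.sub_apply, hD, Module.algebraMap_end_apply, sub_self]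
    · rw [map_sub, AlgHom.commutes, LinearMap.sub_apply, hM, Module.algebraMap_end_apply, sub_self]
  let F := (vermaIdeal p δ μ).liftQ _ hker
  refine ⟨F.restrictScalars K, ?_, fun x u => ?_⟩
  · show F (Submodule.Quotient.mk 1) = w
    simp [F]
  · exact F.map_smul x u

/-- The vacuum vector of the model. -/
noncomputable def vacuum (K : Type*) [Field K] (p : ℕ) : ℕ → MvPolynomial (Fin (p + 1)) K :=
  Pi.single 0 1

theorem fockP_C {n : ℕ} (h : n ≤ p) (a : K) : fockP p μ n (MvPolynomial.C a) = 0 := by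
  rw [fockP_of_le h, MvPolynomial.pderiv_C, smul_zero]

theorem coeffwise_fockP_single_C {n : ℕ} (h : n ≤ p) (i : ℕ) (a : K) :
    coeffwise K _ (fockP p μ n) (Pi.single i (MvPolynomial.C a)) = 0 := by
  funext j
  rw [coeffwise_apply]
  by_cases hj : j = i
  · subst hj; rw [Pi.single_eq_same, fockP_C h]; rfl
  · rw [Pi.single_eq_of_ne hj, map_zero]; rfl

/-- The shift of the `sl₂` weight by `(p+1)²/2` cancels the zero-point term of `oscD`, so the vacuum
has `D`-weight exactly `δ`. -/
theorem exists_verma_model (δ : K) (hμ : μ ≠ 0) :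
    ∃ (L : U K p →ₐ[K] Module.End K (ℕ → MvPolynomial (Fin (p + 1)) K))
      (F : Verma p δ μ →ₗ[K] ℕ → MvPolynomial (Fin (p + 1)) K),
      F (hwv p δ μ) = vacuum K p ∧ (∀ x u, F (x • u) = L x (F u)) ∧
      L (toU (C K p)) = raise K _ + coeffwise K _ (oscC p μ (fockP p μ)) ∧
      L (toU (D K p)) = grade _ (δ + (p + 1) ^ 2 / 2) + coeffwise K _ (oscD p μ (fockP p μ)) ∧
      L (toU (H K p)) = lower _ (δ + (p + 1) ^ 2 / 2) + coeffwise K _ (oscH p μ (fockP p μ)) ∧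
      ∀ n, L (toU (P K p n)) = coeffwise K _ (fockP p μ n) := by
  obtain ⟨L, hC, hD, hH, hM, hP⟩ := exists_model (p := p) δ hμ
  have hv : vacuum K p = Pi.single (0 : ℕ) (MvPolynomial.C (1 : K)) := by rw [vacuum, map_one]
  have h0 : ∀ n ≤ p, coeffwise K _ (fockP p μ n) (vacuum K p) = 0 := fun n hn => by
    rw [hv, coeffwise_fockP_single_C hn]
  have h0' : ∀ n ≤ p, ∀ i, fockP p μ n (vacuum K p i) = 0 := fun n hn i => congrFun (h0 n hn) i
  have hπ := fockP_isHeisenberg p μ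
  have hplus : ∀ X ∈ plus K p, L (toU X) (vacuum K p) = 0 := by
    intro X hX
    induction hX using Submodule.span_induction with
    | mem X hX =>
      rcases hX with rfl | ⟨j, hj, rfl⟩
      · rw [hH]
        funext i
        rw [LinearMap.add_apply, Pi.add_apply, coeffwise_apply,
          hπ.oscH_vacuum fun n hn => h0' n hn i, lower_apply, vacuum,
          Pi.single_eq_of_ne (Nat.succ_ne_zero i)]
        simp
      · rw [hP, h0 j hj]
    | zero => rw [toU, map_zero, map_zero, LinearMap.zero_apply]
    | add x y _ _ hx hy => rw [toU, map_add, map_add, LinearMap.add_apply, hx, hy, add_zero]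
    | smul c x _ hx => rw [toU, map_smul, map_smul, LinearMap.smul_apply, hx, smul_zero]
  have hD' : L (toU (D K p)) (vacuum K p) = δ • vacuum K p := by
    rw [hD]
    funext i
    rw [LinearMap.add_apply, Pi.add_apply, coeffwise_apply,
      hπ.oscD_vacuum hμ fun n hn => h0' n hn i, grade_apply, Pi.smul_apply, ← add_smul]
    rcases i with _ | i
    · congr 1; push_cast; ring
    · rw [vacuum, Pi.single_eq_of_ne (Nat.succ_ne_zero i), smul_zero, smul_zero]
  obtain ⟨F, hF, hFL⟩ := exists_verma_lift L (vacuum K p) hplus hD'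
    (by rw [hM, Module.algebraMap_end_apply])
  exact ⟨L, F, hF, hFL, hC, hD, hH, hP⟩

theorem prod_X_pow (k : Fin (p + 1) → ℕ) :
    ∏ j, (MvPolynomial.X j : MvPolynomial (Fin (p + 1)) K) ^ k j =
      MvPolynomial.monomial (Finsupp.equivFunOnFinite.symm k) 1 := by
  rw [MvPolynomial.monomial_eq, Finsupp.prod_fintype _ _ fun _ => pow_zero _]
  simp

theorem map_ket {δ : K} {L : U K p →ₐ[K] Module.End K (ℕ → MvPolynomial (Fin (p + 1)) K)}
    {F : Verma p δ μ →ₗ[K] ℕ → MvPolynomial (Fin (p + 1)) K}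
    (hF : F (hwv p δ μ) = vacuum K p) (hFL : ∀ x u, F (x • u) = L x (F u))
    (hP : ∀ n, L (toU (P K p n)) = coeffwise K _ (fockP p μ n))
    (h : ℕ) (k : Fin (p + 1) → ℕ) :
    F (ket p δ μ h k) = (L (toU (C K p)) ^ h)
      (Pi.single 0 (MvPolynomial.monomial (Finsupp.equivFunOnFinite.symm k) 1)) := by
  let ψ : MvPolynomial (Fin (p + 1)) K →ₐ[K] Module.End K (ℕ → MvPolynomial (Fin (p + 1)) K) :=
    (coeffwise K _).comp (Algebra.lmul K _)
  have h1 : L (List.ofFn fun j : Fin (p + 1) => toU (P K p (p + 1 + j.val)) ^ k j).prod =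
      ψ (∏ j, MvPolynomial.X j ^ k j) := by
    rw [← List.prod_ofFn, map_list_prod, map_list_prod, List.map_ofFn, List.map_ofFn]
    congr 2
    funext j
    simp only [Function.comp_apply, map_pow, hP, fockP_add]
    rfl
  rw [ket, hFL, hF, map_mul, map_pow, Module.End.mul_apply, h1, prod_X_pow]
  congr 1
  funext i
  show MvPolynomial.monomial _ 1 * vacuum K p i = _
  rw [vacuum]
  rcases i with _ | i
  · simp
  · simp

/-- Linear independence of the kets, without appeal to Poincaré–Birkhoff–Witt. Take a term with the
largest exponent `h` of `C`. At coordinate `h`, terms with a smaller exponent vanish, and terms with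
the same exponent contribute distinct monomials. -/
theorem ketSum_injective_of_model {δ : K}
    {L : U K p →ₐ[K] Module.End K (ℕ → MvPolynomial (Fin (p + 1)) K)}
    {F : Verma p δ μ →ₗ[K] ℕ → MvPolynomial (Fin (p + 1)) K}
    (hF : F (hwv p δ μ) = vacuum K p) (hFL : ∀ x u, F (x • u) = L x (F u))
    (hC : L (toU (C K p)) = raise K _ + coeffwise K _ (oscC p μ (fockP p μ)))
    (hP : ∀ n, L (toU (P K p n)) = coeffwise K _ (fockP p μ n))
    {m : ℕ} {a : LevelIndex p m →₀ K} (ha : F (ketSum p δ μ a) = 0) : a = 0 := by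
  classical
  by_contra hne
  obtain ⟨i, hi, hmax⟩ := Finset.exists_max_image a.support (fun i => i.val.1)
    (Finsupp.support_nonempty_iff.2 hne)
  have h1 := congrArg (fun f : ℕ → MvPolynomial (Fin (p + 1)) K =>
    (f i.val.1).coeff (Finsupp.equivFunOnFinite.symm i.val.2)) ha
  simp only [ketSum, Finsupp.sum, map_sum, map_smul, map_ket hF hFL hP, hC, Finset.sum_apply,
    Pi.smul_apply, MvPolynomial.coeff_sum, MvPolynomial.coeff_smul, Pi.zero_apply,
    MvPolynomial.coeff_zero] at h1
  rw [Finset.sum_eq_single i] at h1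
  · rw [(raise_add_pow_single _ _ _).1, MvPolynomial.coeff_monomial, if_pos rfl, smul_eq_mul,
      mul_one] at h1
    exact Finsupp.mem_support_iff.1 hi h1
  · intro j hj hji
    rcases (hmax j hj).lt_or_eq with hlt | heq
    · rw [(raise_add_pow_single _ _ _).2 _ hlt, MvPolynomial.coeff_zero, smul_zero]
    · rw [← heq, (raise_add_pow_single _ _ _).1, MvPolynomial.coeff_monomial, if_neg, smul_zero]
      intro hk
      exact hji (Subtype.ext (Prod.ext heq (Finsupp.equivFunOnFinite.symm.injective hk)))
  · exact fun h => absurd hi h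

end Model

/-! ### Commutation relations in the enveloping algebra -/

section Enveloping

variable {K : Type*} [Field K] [CharZero K] {p : ℕ}

theorem toU_zero : toU (0 : CGA K p) = 0 := map_zero _

theorem toU_add (X Y : CGA K p) : toU (X + Y) = toU X + toU Y := map_add _ _ _

theorem toU_neg (X : CGA K p) : toU (-X) = -toU X := map_neg _ _

theorem toU_smul (c : K) (X : CGA K p) : toU (c • X) = c • toU X := map_smul _ _ _

theorem smul_smul_verma {δ μ : K} (c : K) (x : U K p) (u : Verma p δ μ) :
    (c • x) • u = c • x • u := smul_assoc _ _ _

theorem mul_smul_verma {δ μ : K} (x y : U K p) (u : Verma p δ μ) :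
    (x * y) • u = x • y • u := mul_smul _ _ _

theorem toU_mul_comm (X Y : CGA K p) : toU X * toU Y = toU Y * toU X + toU (bracket K p X Y) := by
  have h : toU (bracket K p X Y) = toU X * toU Y - toU Y * toU X :=
    (UniversalEnvelopingAlgebra.ι K).map_lie X Y
  rw [h]; abel

variable (K p)

theorem toU_P_comm {m n : ℕ} (h : m + n ≠ 2 * p + 1) :
    Commute (toU (P K p m)) (toU (P K p n)) := by
  have h1 := toU_mul_comm (P K p m) (P K p n)
  rw [bracket_P_P, if_neg h, toU_zero, add_zero] at h1
  exact h1

theorem toU_P_C {n : ℕ} (hn : n < 2 * p + 2) :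
    toU (P K p n) * toU (C K p) =
      toU (C K p) * toU (P K p n) - ((2 * p + 1 : K) - n) • toU (P K p (n + 1)) := by
  rw [toU_mul_comm (C K p), bracket_C_P K p n hn, toU_smul]; abel

theorem toU_D_C : toU (D K p) * toU (C K p) =
    toU (C K p) * toU (D K p) - (2 : K) • toU (C K p) := by
  rw [toU_mul_comm, show bracket K p (D K p) (C K p) = -((2 : K) • C K p) from
    bracket_gen K p .D .C, toU_neg, toU_smul, sub_eq_add_neg]

theorem toU_D_P (n : ℕ) : toU (D K p) * toU (P K p n) =
    toU (P K p n) * toU (D K p) + ((2 * p + 1 : K) - 2 * n) • toU (P K p n) := by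
  rw [toU_mul_comm, bracket_D_P, toU_smul]

theorem toU_H_C : toU (H K p) * toU (C K p) = toU (C K p) * toU (H K p) - toU (D K p) := by
  rw [toU_mul_comm, show bracket K p (H K p) (C K p) = -D K p from
    bracket_gen K p .H .C, toU_neg, sub_eq_add_neg]

theorem toU_H_P {n : ℕ} (hn : n < 2 * p + 2) : toU (H K p) * toU (P K p n) =
    toU (P K p n) * toU (H K p) - (n : K) • toU (P K p (n - 1)) := by
  rw [toU_mul_comm, bracket_H_P K p n hn, toU_neg, toU_smul, sub_eq_add_neg]

end Enveloping

/-! ### The highest weight vector and the grading by levels -/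

section Highest

variable {K : Type*} [Field K] [CharZero K] {p : ℕ} {δ μ : K}

theorem smul_hwv_eq_zero {x : U K p} (hx : x ∈ vermaIdeal p δ μ) : x • hwv p δ μ = 0 := by
  rw [hwv, ← map_smul, smul_eq_mul, mul_one, Submodule.mkQ_apply]
  exact (Submodule.Quotient.mk_eq_zero _).2 hx

theorem plus_smul_hwv {X : CGA K p} (hX : X ∈ plus K p) : toU X • hwv p δ μ = 0 :=
  smul_hwv_eq_zero (Submodule.subset_span (Or.inl ⟨X, hX, rfl⟩))

theorem H_mem_plus : H K p ∈ plus K p := Submodule.subset_span (Or.inl rfl)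

theorem P_mem_plus {n : ℕ} (hn : n ≤ p) : P K p n ∈ plus K p :=
  Submodule.subset_span (Or.inr ⟨n, hn, rfl⟩)

theorem D_smul_hwv : toU (D K p) • hwv p δ μ = δ • hwv p δ μ := by
  have h : (toU (D K p) - algebraMap K (U K p) δ) • hwv p δ μ = 0 :=
    smul_hwv_eq_zero (Submodule.subset_span (Or.inr (Or.inl rfl)))
  rwa [sub_smul, algebraMap_smul, sub_eq_zero] at h

theorem M_smul_hwv : toU (M K p) • hwv p δ μ = μ • hwv p δ μ := by
  have h : (toU (M K p) - algebraMap K (U K p) μ) • hwv p δ μ = 0 :=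
    smul_hwv_eq_zero (Submodule.subset_span (Or.inr (Or.inr rfl)))
  rwa [sub_smul, algebraMap_smul, sub_eq_zero] at h

theorem commute_M (X : CGA K p) : Commute (toU (M K p)) (toU X) := by
  have h := toU_mul_comm (M K p) X
  rwa [bracket_M_left, toU_zero, add_zero] at h

theorem M_smul_smul (X : CGA K p) {u : Verma p δ μ} (hu : toU (M K p) • u = μ • u) :
    toU (M K p) • toU X • u = μ • toU X • u := by
  rw [← mul_smul_verma, (commute_M X).eq, mul_smul_verma, hu, smul_comm]

theorem P_smul_P_smul {m n : ℕ} (h : m + n = 2 * p + 1) {u : Verma p δ μ}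
    (hu : toU (M K p) • u = μ • u) :
    toU (P K p m) • toU (P K p n) • u =
      toU (P K p n) • toU (P K p m) • u + (structI K p m * μ) • u := by
  rw [← mul_smul_verma, toU_mul_comm, bracket_P_P, if_pos h, add_smul, mul_smul_verma, toU_smul,
    smul_smul_verma, hu, smul_smul (structI K p m)]

/-- `D` has commutator `-w x` with `x`. -/
def HasWeight (x : U K p) (w : K) : Prop := toU (D K p) * x = x * toU (D K p) - w • x

theorem hasWeight_one : HasWeight (1 : U K p) 0 := by simp [HasWeight]

theorem HasWeight.mul {x y : U K p} {v w : K} (hx : HasWeight x v) (hy : HasWeight y w) :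
    HasWeight (x * y) (v + w) := by
  unfold HasWeight at *
  rw [← mul_assoc, hx, sub_mul, mul_assoc, hy, mul_sub, ← mul_assoc, mul_smul_comm, smul_mul_assoc]
  module

theorem HasWeight.pow {x : U K p} {w : K} (hx : HasWeight x w) (n : ℕ) :
    HasWeight (x ^ n) (n * w) := by
  induction n with
  | zero => simpa using hasWeight_one
  | succ n ih =>
    rw [pow_succ]
    convert ih.mul hx using 1
    push_cast
    ring

theorem HasWeight.list_prod_ofFn {n : ℕ} {x : Fin n → U K p} {w : Fin n → K}
    (h : ∀ i, HasWeight (x i) (w i)) : HasWeight (List.ofFn x).prod (∑ i, w i) := by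
  induction n with
  | zero => simpa using hasWeight_one
  | succ n ih =>
    rw [List.ofFn_succ, List.prod_cons, Fin.sum_univ_succ]
    exact (h 0).mul (ih fun i => h i.succ)

theorem HasWeight.smul_eq {x : U K p} {w d : K} (hx : HasWeight x w) {u : Verma p δ μ}
    (hu : toU (D K p) • u = d • u) : toU (D K p) • x • u = (d - w) • x • u := by
  rw [← mul_smul_verma, hx, sub_smul, mul_smul_verma, hu, sub_smul, smul_smul_verma, smul_comm]

theorem hasWeight_C : HasWeight (toU (C K p)) 2 := toU_D_C K p

theorem hasWeight_P (j : ℕ) : HasWeight (toU (P K p (p + 1 + j))) (2 * j + 1) := by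
  rw [HasWeight, toU_D_P]
  push_cast
  module

/-- Weights add under products: each `C` lowers the `D`-eigenvalue by `2` and each `P_{p+1+j}` by
`2j + 1`. -/
theorem D_smul_level {m : ℕ} {u : Verma p δ μ} (hu : u ∈ level p δ μ m) :
    toU (D K p) • u = (δ - m) • u := by
  induction hu using Submodule.span_induction with
  | mem u hu =>
    obtain ⟨⟨⟨h, k⟩, hm⟩, rfl⟩ := hu
    have hw := (hasWeight_C (K := K) (p := p)).pow h |>.mul
      (HasWeight.list_prod_ofFn fun j : Fin (p + 1) => (hasWeight_P (K := K) (j : ℕ)).pow (k j))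
    show toU (D K p) • ket p δ μ h k = _
    rw [ket, hw.smul_eq D_smul_hwv]
    congr 2
    rw [← hm]
    push_cast
    congr 1
    · ring
    · exact Finset.sum_congr rfl fun j _ => by ring
  | zero => simp
  | add x y _ _ hx hy => rw [smul_add, hx, hy, smul_add]
  | smul c x _ hx => rw [smul_comm, hx, smul_comm]

theorem ket_mem_level {m h : ℕ} {k : Fin (p + 1) → ℕ}
    (hm : 2 * h + ∑ j : Fin (p + 1), (2 * j.val + 1) * k j = m) :
    ket p δ μ h k ∈ level p δ μ m :=
  Submodule.subset_span ⟨⟨(h, k), hm⟩, rfl⟩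

theorem C_smul_ket (h : ℕ) (k : Fin (p + 1) → ℕ) :
    toU (C K p) • ket p δ μ h k = ket p δ μ (h + 1) k := by
  rw [ket, ket, ← mul_smul_verma, pow_succ', mul_assoc]

theorem C_smul_mem_level {m : ℕ} {u : Verma p δ μ} (hu : u ∈ level p δ μ m) :
    toU (C K p) • u ∈ level p δ μ (m + 2) := by
  induction hu using Submodule.span_induction with
  | mem u hu =>
    obtain ⟨⟨⟨h, k⟩, hm⟩, rfl⟩ := hu
    change 2 * h + ∑ j : Fin (p + 1), (2 * j.val + 1) * k j = m at hm
    show toU (C K p) • ket p δ μ h k ∈ _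
    rw [C_smul_ket]
    exact ket_mem_level (by omega)
  | zero => rw [smul_zero]; exact Submodule.zero_mem _
  | add x y _ _ hx hy => rw [smul_add]; exact Submodule.add_mem _ hx hy
  | smul c x _ hx => rw [smul_comm]; exact Submodule.smul_mem _ c hx

theorem list_prod_ofFn_update {A : Type*} [Monoid A] {n : ℕ} (x : Fin n → A)
    (hx : ∀ i j, Commute (x i) (x j)) (k : Fin n → ℕ) (i : Fin n) :
    x i * (List.ofFn fun j => x j ^ k j).prod =
      (List.ofFn fun j => x j ^ (k + (Pi.single i 1 : Fin n → ℕ)) j).prod := by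
  induction n with
  | zero => exact i.elim0
  | succ n ih =>
    rw [List.ofFn_succ, List.ofFn_succ, List.prod_cons, List.prod_cons]
    refine Fin.cases ?_ (fun i => ?_) i
    · rw [← mul_assoc, ← pow_succ']
      congr 3
    · rw [← mul_assoc, ((hx i.succ 0).pow_right _).eq, mul_assoc,
        ih (fun j => x j.succ) (fun _ _ => hx _ _) (fun j => k j.succ) i]
      congr 3
      funext j
      simp [Pi.single_apply]

theorem P_smul_ket_zero (i : Fin (p + 1)) (k : Fin (p + 1) → ℕ) :
    toU (P K p (p + 1 + i)) • ket p δ μ 0 k = ket p δ μ 0 (k + Pi.single i 1) := by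
  rw [ket, ket, pow_zero, one_mul, one_mul, ← mul_smul_verma,
    list_prod_ofFn_update (fun j : Fin (p + 1) => toU (P K p (p + 1 + j.val)))
      (fun i j => toU_P_comm K p (by omega))]

/-- Moving `P` to the right past a factor `C` leaves a correction with one `C` fewer and the index
of `P` raised by one, at the same level. The induction therefore has to allow all `i`, including
indices out of range, where `P` is zero. -/
theorem P_smul_ket_mem_level (h : ℕ) (k : Fin (p + 1) → ℕ) {i m : ℕ}
    (hm : 2 * h + ∑ j : Fin (p + 1), (2 * j.val + 1) * k j + (2 * i + 1) = m) :
    toU (P K p (p + 1 + i)) • ket p δ μ h k ∈ level p δ μ m := by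
  induction h generalizing i m with
  | zero =>
    by_cases hi : i < p + 1
    · rw [P_smul_ket_zero ⟨i, hi⟩]
      refine ket_mem_level ?_
      rw [← hm]
      simp [mul_add, Finset.sum_add_distrib, Pi.single_apply]
    · rw [P_of_ge K p _ (by omega), toU_zero, zero_smul]
      exact Submodule.zero_mem _
  | succ h ih =>
    by_cases hi : i < p + 1
    · rw [← C_smul_ket, ← mul_smul_verma, toU_P_C K p (by omega), sub_smul, mul_smul_verma, smul_smul_verma]
      obtain ⟨m, rfl⟩ : ∃ m', m = m' + 2 := ⟨m - 2, by omega⟩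
      refine Submodule.sub_mem _ (C_smul_mem_level (ih (by omega))) (Submodule.smul_mem _ _ ?_)
      exact ih (i := i + 1) (by omega)
    · rw [P_of_ge K p _ (by omega), toU_zero, zero_smul]
      exact Submodule.zero_mem _

theorem P_smul_mem_level {m : ℕ} {u : Verma p δ μ} (i : ℕ) (hu : u ∈ level p δ μ m) :
    toU (P K p (p + 1 + i)) • u ∈ level p δ μ (m + (2 * i + 1)) := by
  induction hu using Submodule.span_induction with
  | mem u hu =>
    obtain ⟨⟨⟨h, k⟩, hm⟩, rfl⟩ := hu
    change 2 * h + ∑ j : Fin (p + 1), (2 * j.val + 1) * k j = m at hm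
    exact P_smul_ket_mem_level h k (by omega)
  | zero => rw [smul_zero]; exact Submodule.zero_mem _
  | add x y _ _ hx hy => rw [smul_add]; exact Submodule.add_mem _ hx hy
  | smul c x _ hx => rw [smul_comm]; exact Submodule.smul_mem _ c hx

end Highest

/-! ### The explicit singular vector -/

section SingVec

variable {K : Type*} [Field K] [CharZero K] {p : ℕ} {δ μ : K}

theorem singVec_zero : singVec p δ μ 0 = hwv p δ μ := by rw [singVec, pow_zero, one_smul]

theorem singVec_succ (q : ℕ) : singVec p δ μ (q + 1) =
    (2 * (p.factorial : K) ^ 2 * μ) • toU (C K p) • singVec p δ μ q -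
      toU (P K p (p + 1)) • toU (P K p (p + 1)) • singVec p δ μ q := by
  rw [singVec, singVec, pow_succ', mul_smul_verma, sub_smul, smul_smul_verma, pow_two (toU _),
    mul_smul_verma]

theorem singVec_mem_level (q : ℕ) : singVec p δ μ q ∈ level p δ μ (2 * q) := by
  induction q with
  | zero =>
    rw [singVec_zero]
    have h : hwv p δ μ = ket p δ μ 0 0 := by simp [ket]
    rw [h]
    exact ket_mem_level (by simp)
  | succ q ih =>
    rw [singVec_succ]
    refine Submodule.sub_mem _ (Submodule.smul_mem _ _ (C_smul_mem_level ih)) ?_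
    exact P_smul_mem_level 0 (P_smul_mem_level 0 ih)

theorem M_smul_singVec (q : ℕ) : toU (M K p) • singVec p δ μ q = μ • singVec p δ μ q := by
  induction q with
  | zero => rw [singVec_zero, M_smul_hwv]
  | succ q ih =>
    rw [singVec_succ, smul_sub, smul_sub, smul_comm (toU (M K p)), M_smul_smul _ ih,
      M_smul_smul _ (M_smul_smul _ ih), smul_comm μ (2 * (p.factorial : K) ^ 2 * μ)]

/-- For `n < p` the only correction comes from `C` and involves `P_{n+1}`, which kills the previous
power. For `n = p` both `C` and `P_{p+1}²` give multiples of `P_{p+1}`, and `α` is the constant for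
which they cancel. -/
theorem P_smul_singVec {n : ℕ} (hn : n ≤ p) (q : ℕ) : toU (P K p n) • singVec p δ μ q = 0 := by
  induction q generalizing n with
  | zero => rw [singVec_zero, plus_smul_hwv (P_mem_plus hn)]
  | succ q ih =>
    rw [singVec_succ, smul_sub, smul_comm, ← mul_smul_verma (toU (P K p n)) (toU (C K p)),
      toU_P_C K p (by omega), sub_smul, mul_smul_verma, ih hn, smul_zero, zero_sub]
    rcases hn.lt_or_eq with h | rfl
    · have h1 := (toU_P_comm K p (m := n) (n := p + 1) (by omega)).eq
      rw [← mul_smul_verma (toU (P K p n)), h1, mul_smul_verma, ← mul_smul_verma (toU (P K p n)), h1, mul_smul_verma,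
        ih hn, smul_smul_verma, ih h]
      simp
    · rw [P_smul_P_smul (by omega) (M_smul_smul _ (M_smul_singVec q)),
        P_smul_P_smul (by omega) (M_smul_singVec q), ih le_rfl,
        structI_mid, smul_zero, zero_add, smul_comm (toU (P K n (n + 1))), smul_smul_verma]
      generalize toU (P K n (n + 1)) • singVec n δ μ q = v
      module

/-- The usual `sl₂` computation: the scalar is `αμ` times the factor `-(q+1)(d-q)` of `lower`, for
`d = δ + (p+1)²/2`. -/
theorem H_smul_singVec_succ (q : ℕ) : toU (H K p) • singVec p δ μ (q + 1) =
    (-((p.factorial : K) ^ 2 * μ * (q + 1) * (2 * δ - 2 * q + (p + 1) ^ 2))) •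
      singVec p δ μ q := by
  have hPP : ∀ q, toU (H K p) • toU (P K p (p + 1)) • toU (P K p (p + 1)) • singVec p δ μ q =
      toU (P K p (p + 1)) • toU (P K p (p + 1)) • toU (H K p) • singVec p δ μ q +
        (((p : K) + 1) ^ 2 * (p.factorial : K) ^ 2 * μ) • singVec p δ μ q := by
    intro q
    have e : ∀ u : Verma p δ μ, toU (H K p) • toU (P K p (p + 1)) • u =
        toU (P K p (p + 1)) • toU (H K p) • u - (p + 1 : K) • toU (P K p p) • u := fun u => by
      rw [← mul_smul_verma, toU_H_P K p (by omega), sub_smul, mul_smul_verma, smul_smul_verma, Nat.add_sub_cancel]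
      push_cast
      rfl
    rw [e, e, smul_sub, smul_comm (toU (P K p (p + 1))) (p + 1 : K), P_smul_P_smul (m := p) (n := p + 1) (by omega) (M_smul_singVec q), P_smul_singVec le_rfl, structI_mid,
      smul_zero, smul_zero]
    generalize toU (P K p (p + 1)) • toU (P K p (p + 1)) • toU (H K p) • singVec p δ μ q = v
    module
  have hC : ∀ q, toU (H K p) • toU (C K p) • singVec p δ μ q =
      toU (C K p) • toU (H K p) • singVec p δ μ q - (δ - 2 * q) • singVec p δ μ q := by
    intro q
    rw [← mul_smul_verma, toU_H_C, sub_smul, mul_smul_verma, D_smul_level (singVec_mem_level q)]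
    push_cast
    rfl
  induction q with
  | zero =>
    rw [singVec_succ, smul_sub, smul_comm, hC, hPP, singVec_zero, plus_smul_hwv H_mem_plus]
    simp only [smul_zero]
    push_cast
    module
  | succ q ih =>
    rw [singVec_succ (q + 1), smul_sub, smul_comm, hC, hPP, ih]
    have hc : ∀ (c : K) (x : U K p) (u : Verma p δ μ), x • c • u = c • x • u :=
      fun c x u => smul_comm x c u
    simp only [hc]
    -- The scalar from `ih` multiplies `αμC - P_{p+1}²` applied to the vector of index `q`. Once the
    -- remaining vectors of index `q + 1` are unfolded, both sides are combinations of the same two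
    -- vectors.
    rw [singVec_succ q]
    generalize toU (C K p) • singVec p δ μ q = v
    generalize toU (P K p (p + 1)) • toU (P K p (p + 1)) • singVec p δ μ q = w
    push_cast
    module

theorem plus_smul_singVec {q : ℕ} (hq : 1 ≤ q)
    (h : 2 * δ - 2 * ((q : K) - 1) + ((p : K) + 1) ^ 2 = 0) {X : CGA K p} (hX : X ∈ plus K p) :
    toU X • singVec p δ μ q = 0 := by
  induction hX using Submodule.span_induction with
  | mem X hX =>
    rcases hX with rfl | ⟨j, hj, rfl⟩
    · obtain ⟨q, rfl⟩ : ∃ r, q = r + 1 := ⟨q - 1, by omega⟩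
      push_cast at h
      rw [add_sub_cancel_right] at h
      rw [H_smul_singVec_succ, h, mul_zero, neg_zero, zero_smul]
    · exact P_smul_singVec hj q
  | zero => rw [toU_zero, zero_smul]
  | add x y _ _ hx hy => rw [toU_add, add_smul, hx, hy, add_zero]
  | smul c x _ hx => rw [toU_smul, smul_smul_verma, hx, smul_zero]

end SingVec

/-! ### Classification of the singular vectors -/

section Singular

variable {K : Type*} [Field K] [CharZero K] {p : ℕ} {δ μ : K}

theorem exists_ketSum {m : ℕ} {u : Verma p δ μ} (hu : u ∈ level p δ μ m) :
    ∃ a : LevelIndex p m →₀ K, u = ketSum p δ μ a := by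
  obtain ⟨a, ha⟩ := Finsupp.mem_span_range_iff_exists_finsupp.1 hu
  exact ⟨a, ha.symm⟩

theorem ketSum_sub_smul {m : ℕ} (a b : LevelIndex p m →₀ K) (c : K) :
    ketSum p δ μ (b - c • a) = ketSum p δ μ b - c • ketSum p δ μ a := by
  have h : ∀ a : LevelIndex p m →₀ K, ketSum p δ μ a =
    Finsupp.linearCombination K (fun i : LevelIndex p m => ket p δ μ i.val.1 i.val.2) a :=
    fun _ => rfl
  rw [h, h, h, map_sub, map_smul]

theorem ketSum_eq_zero (hμ : μ ≠ 0) {m : ℕ} {a : LevelIndex p m →₀ K}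
    (h : ketSum p δ μ a = 0) : a = 0 := by
  obtain ⟨L, F, hF, hFL, hC, -, -, hP⟩ := exists_verma_model (p := p) δ hμ
  exact ketSum_injective_of_model hF hFL hC hP (by rw [h, map_zero])

/-- In the model, a singular vector is a multiple of a power of the raising operator applied to
the vacuum. -/
theorem IsSingular.map_model (hμ : μ ≠ 0)
    {L : U K p →ₐ[K] Module.End K (ℕ → MvPolynomial (Fin (p + 1)) K)}
    {F : Verma p δ μ →ₗ[K] ℕ → MvPolynomial (Fin (p + 1)) K}
    (hF : F (hwv p δ μ) = vacuum K p) (hFL : ∀ x u, F (x • u) = L x (F u))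
    (hC : L (toU (C K p)) = raise K _ + coeffwise K _ (oscC p μ (fockP p μ)))
    (hD : L (toU (D K p)) = grade _ (δ + (p + 1) ^ 2 / 2) + coeffwise K _ (oscD p μ (fockP p μ)))
    (hH : L (toU (H K p)) = lower _ (δ + (p + 1) ^ 2 / 2) + coeffwise K _ (oscH p μ (fockP p μ)))
    (hP : ∀ n, L (toU (P K p n)) = coeffwise K _ (fockP p μ n))
    {m : ℕ} {u : Verma p δ μ} (hu : IsSingular p δ μ m u) :
    ∃ (q : ℕ) (a : K), 1 ≤ q ∧ m = 2 * q ∧ 2 * δ - 2 * ((q : K) - 1) + ((p : K) + 1) ^ 2 = 0 ∧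
      a ≠ 0 ∧ F u = Pi.single q (MvPolynomial.C a) := by
  obtain ⟨hm, hlev, hu0, hplus⟩ := hu
  have hFu : F u ≠ 0 := by
    intro h
    obtain ⟨a, rfl⟩ := exists_ketSum hlev
    have ha := ketSum_injective_of_model hF hFL hC hP h
    exact hu0 (by simp [ha, ketSum])
  have hvac : ∀ n ≤ p, ∀ i, fockP p μ n (F u i) = 0 := fun n hn i => by
    have h := hFL (toU (P K p n)) u
    rw [hplus _ (P_mem_plus hn), map_zero, hP] at h
    exact (congrFun h i).symm
  have hπ := fockP_isHeisenberg p μ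
  -- The entries of `F u` are vacuum vectors, so the zero-point term cancels the weight shift and
  -- coordinate `i` has `D`-weight `δ - 2i`.
  have hgrade : ∀ i : ℕ, (δ - 2 * i : K) • F u i = (δ - m) • F u i := fun i => by
    have h := hFL (toU (D K p)) u
    rw [D_smul_level hlev, map_smul, hD] at h
    have h := congrFun h i
    rw [Pi.smul_apply, LinearMap.add_apply, Pi.add_apply, coeffwise_apply, grade_apply,
      hπ.oscD_vacuum hμ fun n hn => hvac n hn i, ← add_smul] at h
    rw [h]
    congr 1
    ring
  have hlower : ∀ i : ℕ, (-((i + 1 : K) * (δ + (p + 1) ^ 2 / 2 - i))) • F u (i + 1) = 0 := fun i => by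
    have h := hFL (toU (H K p)) u
    rw [hplus _ H_mem_plus, map_zero, hH] at h
    have h := congrFun h i
    rw [LinearMap.add_apply, Pi.add_apply, coeffwise_apply, lower_apply,
      hπ.oscH_vacuum fun n hn => hvac n hn i, add_zero] at h
    exact h.symm
  -- In characteristic zero the grading leaves at most one nonzero coordinate; this forces `m` to be
  -- even.
  have hsupp : ∀ i, F u i ≠ 0 → 2 * i = m := fun i hi => by
    have h := smul_left_injective K hi (hgrade i)
    have h' : (2 * i : K) = m := by linear_combination -h
    exact_mod_cast h'
  obtain ⟨q, hq⟩ : ∃ q, F u q ≠ 0 := by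
    by_contra! h
    exact hFu (funext h)
  have hmq := hsupp q hq
  obtain ⟨a, ha⟩ : ∃ a, F u q = MvPolynomial.C a := by
    refine eq_C_of_pderiv_eq_zero fun i => ?_
    have h := hvac (p - i) (by omega) q
    rw [fockP_of_le (by omega), smul_eq_zero] at h
    have e : (⟨p - (p - i), by omega⟩ : Fin (p + 1)) = i := by ext; simp; omega
    rw [e] at h
    exact h.resolve_left (mul_ne_zero (structI_ne_zero K p _) hμ)
  refine ⟨q, a, by omega, hmq.symm, ?_, ?_, ?_⟩
  · obtain ⟨r, rfl⟩ : ∃ r, q = r + 1 := ⟨q - 1, by omega⟩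
    -- Coordinate `r = q - 1` of the equation for `H` forces `(r + 1)(d - r) = 0`, that is `d = q -
    -- 1`.
    have h := (smul_eq_zero.1 (hlower r)).resolve_right hq
    have h2 := (mul_eq_zero.1 (neg_eq_zero.1 h)).resolve_left (Nat.cast_add_one_ne_zero r)
    push_cast
    linear_combination 2 * h2
  · rintro rfl
    exact hq (by rw [ha, map_zero])
  · funext i
    by_cases hi : i = q
    · subst hi; rw [ha, Pi.single_eq_same]
    · rw [Pi.single_eq_of_ne hi]
      by_contra h
      have := hsupp i h
      omega

theorem IsSingular.level_eq (hμ : μ ≠ 0) {m : ℕ} {u : Verma p δ μ} (hu : IsSingular p δ μ m u) :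
    ∃ q : ℕ, 1 ≤ q ∧ m = 2 * q ∧ 2 * δ - 2 * ((q : K) - 1) + ((p : K) + 1) ^ 2 = 0 := by
  obtain ⟨L, F, hF, hFL, hC, hD, hH, hP⟩ := exists_verma_model (p := p) δ hμ
  obtain ⟨q, a, h1, h2, h3, -⟩ := hu.map_model hμ hF hFL hC hD hH hP
  exact ⟨q, h1, h2, h3⟩

/-- Both images are nonzero constants in the same coordinate, hence proportional; injectivity on
sums of kets carries this back. -/
theorem IsSingular.exists_eq_smul (hμ : μ ≠ 0) {m : ℕ} {u v : Verma p δ μ}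
    (hu : IsSingular p δ μ m u) (hv : IsSingular p δ μ m v) : ∃ c : K, c ≠ 0 ∧ v = c • u := by
  obtain ⟨L, F, hF, hFL, hC, hD, hH, hP⟩ := exists_verma_model (p := p) δ hμ
  obtain ⟨q, a, -, hq, -, ha, hFu⟩ := hu.map_model hμ hF hFL hC hD hH hP
  obtain ⟨r, b, -, hr, -, hb, hFv⟩ := hv.map_model hμ hF hFL hC hD hH hP
  obtain rfl : q = r := by omega
  refine ⟨b / a, div_ne_zero hb ha, ?_⟩
  obtain ⟨x, rfl⟩ := exists_ketSum hu.2.1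
  obtain ⟨y, rfl⟩ := exists_ketSum hv.2.1
  have h : F (ketSum p δ μ (y - (b / a) • x)) = 0 := by
    rw [ketSum_sub_smul, map_sub, map_smul, hFu, hFv, ← Pi.single_smul, ← MvPolynomial.C_mul',
      ← MvPolynomial.C_mul, div_mul_cancel₀ _ ha, sub_self]
  have h' := ketSum_injective_of_model hF hFL hC hP h
  rw [← sub_eq_zero, ← ketSum_sub_smul, h', ketSum, Finsupp.sum_zero_index]

/-- By `oscC_vacuum`, `αμC - P_{p+1}²` acts on vacuum vectors of the model as `αμ` times `raise`, so
the image is the constant `(αμ)^q` in coordinate `q`. -/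
theorem singVec_ne_zero (hμ : μ ≠ 0) (q : ℕ) : singVec p δ μ q ≠ 0 := by
  obtain ⟨L, F, hF, hFL, hC, -, -, hP⟩ := exists_verma_model (p := p) δ hμ
  have hα : (2 * (p.factorial : K) ^ 2 * μ) ≠ 0 :=
    mul_ne_zero (mul_ne_zero two_ne_zero (pow_ne_zero 2 (Nat.cast_ne_zero.2 p.factorial_ne_zero))) hμ
  have hπ := fockP_isHeisenberg p μ
  have key : F (singVec p δ μ q) =
      Pi.single q (MvPolynomial.C ((2 * (p.factorial : K) ^ 2 * μ) ^ q)) := by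
    induction q with
    | zero => rw [singVec_zero, hF, pow_zero, map_one]; rfl
    | succ q ih =>
      rw [singVec_succ, map_sub, map_smul, hFL, hFL, hFL, hC, hP, ih]
      funext i
      rw [Pi.sub_apply, Pi.smul_apply, LinearMap.add_apply, Pi.add_apply, coeffwise_apply,
        coeffwise_apply, coeffwise_apply, smul_add, hπ.oscC_vacuum hμ, add_sub_cancel_right]
      · rcases i with _ | i
        · rw [raise_zero, smul_zero, Pi.single_eq_of_ne (Nat.succ_ne_zero q).symm]
        · rw [raise_succ]
          by_cases hi : i = q
          · subst hi
            rw [Pi.single_eq_same, Pi.single_eq_same, ← MvPolynomial.C_mul', ← MvPolynomial.C_mul,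
              ← pow_succ']
          · rw [Pi.single_eq_of_ne hi, Pi.single_eq_of_ne (by omega), smul_zero]
      · intro n hn
        exact congrFun (coeffwise_fockP_single_C hn q _) i
  intro h
  rw [h, map_zero, eq_comm, Pi.single_eq_zero_iff, MvPolynomial.C_eq_zero] at key
  exact pow_ne_zero q hα key

theorem isSingular_singVec (hμ : μ ≠ 0) {q : ℕ} (hq : 1 ≤ q)
    (h : 2 * δ - 2 * ((q : K) - 1) + ((p : K) + 1) ^ 2 = 0) :
    IsSingular p δ μ (2 * q) (singVec p δ μ q) :=
  ⟨by omega, singVec_mem_level q, singVec_ne_zero hμ q, fun _ hX => plus_smul_singVec hq h hX⟩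

end Singular

end CGA

theorem theorem4 {K : Type*} [Field K] [CharZero K] (p : ℕ) (δ μ : K) (hμ : μ ≠ 0) :
    -- a singular vector can occur only at an even level
    (∀ (m : ℕ) (a : CGA.LevelIndex p m →₀ K),
      CGA.IsSingular p δ μ m (CGA.ketSum p δ μ a) → Even m) ∧
    -- its coefficients are unique up to an overall factor
    (∀ (m : ℕ) (a b : CGA.LevelIndex p m →₀ K),
      CGA.IsSingular p δ μ m (CGA.ketSum p δ μ a) →
      CGA.IsSingular p δ μ m (CGA.ketSum p δ μ b) → ∃ c : K, c ≠ 0 ∧ b = c • a) ∧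
    -- a singular vector occurs only at a level `2q` with `2δ - 2(q-1) + (ℓ+1/2)² = 0`
    (∀ (m : ℕ) (u : CGA.Verma p δ μ), CGA.IsSingular p δ μ m u →
      ∃ q : ℕ, 1 ≤ q ∧ m = 2 * q ∧ 2 * δ - 2 * ((q : K) - 1) + ((p : K) + 1) ^ 2 = 0) ∧
    -- and under this condition there is exactly one, up to nonzero multiples
    (∀ q : ℕ, 1 ≤ q → 2 * δ - 2 * ((q : K) - 1) + ((p : K) + 1) ^ 2 = 0 →
      CGA.IsSingular p δ μ (2 * q) (CGA.singVec p δ μ q) ∧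
      ∀ (m : ℕ) (u : CGA.Verma p δ μ), CGA.IsSingular p δ μ m u →
        m = 2 * q ∧ ∃ c : K, c ≠ 0 ∧ u = c • CGA.singVec p δ μ q) := by
  refine ⟨fun m a ha => ?_, fun m a b ha hb => ?_, fun m u hu => hu.level_eq hμ,
    fun q hq h => ⟨CGA.isSingular_singVec hμ hq h, fun m u hu => ?_⟩⟩
  · obtain ⟨q, -, rfl, -⟩ := ha.level_eq hμ
    exact even_two_mul q
  · obtain ⟨c, hc, h⟩ := ha.exists_eq_smul hμ hb
    refine ⟨c, hc, sub_eq_zero.1 (CGA.ketSum_eq_zero (δ := δ) hμ ?_)⟩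
    rw [CGA.ketSum_sub_smul, h, sub_self]
  · obtain ⟨r, -, rfl, hr⟩ := hu.level_eq hμ
    -- The condition is affine in `q` with nonzero slope, so `δ` admits at most one level.
    have hrq : (r : K) = q := by linear_combination (1 / 2) * (h - hr)
    obtain rfl : r = q := Nat.cast_injective hrq
    exact ⟨rfl, (CGA.isSingular_singVec hμ hq h).exists_eq_smul hμ hu⟩
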